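/- Let $\mathbb{S}^2\subset\mathbb{R}^3$ be the unit sphere with its surface measure $dx$ (of total mass $4\pi$), and let $P_l(t)=\frac{1}{2^l l!}\frac{d^l}{dt^l}(t^2-1)^l$ be the $l$-th Legendre polynomial. For every integer $l\ge 1$ let $f_l$ be a Gaussian random spherical eigenfunction of degree $l$, i.e. a centred Gaussian random field on $\mathbb{S}^2$ with (almost surely) continuous sample paths and covariance function $\mathbb{E}[f_l(x)f_l(y)]=P_l(\langle x,y\rangle)$, $x,y\in\mathbb{S}^2$. Put $$h_{l;4}=\int_{\mathbb{S}^2}H_4(f_l(x))\,dx,\qquad H_4(u)=u^4-6u^2+3,$$ where $H_4$ is the fourth Hermite polynomial. Then: 1. For every $l\ge 1$ the random variable $h_{l;4}$ is square integrable and $$\operatorname{Var}(h_{l;4})=4!\,(4\pi)^2\int_0^1 P_l(t)^4\,dt .$$ 2. As $l\to\infty$, $$\int_0^1 P_l(t)^4\,dt\sim\frac{3}{2\pi^2}\,\frac{\log l}{l^2},$$ and in particular $$\operatorname{Var}(h_{l;4})\sim 24^2\,\frac{\log l}{l^2}.$$ Here $a_l\sim b_l$ means $a_l/b_l\to 1$.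 -/

import Mathlib

open MeasureTheory ProbabilityTheory Filter Asymptotics

noncomputable section

/-- The unit sphere `S²` of three-dimensional Euclidean space. -/
abbrev S2 : Type := Metric.sphere (0 : EuclideanSpace ℝ (Fin 3)) 1

/-- The surface measure `dx` of `S²`, of total mass `4π`. -/
def surfaceMeasure : Measure S2 :=
  (volume : Measure (EuclideanSpace ℝ (Fin 3))).toSphere

/-- The Legendre polynomial `P_l`, by Rodrigues' formula
`P_l(t) = (1 / (2 ^ l l!)) (d/dt)^l (t² - 1)^l`. -/
def legendreP (l : ℕ) : Polynomial ℝ :=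
  Polynomial.C (1 / (2 ^ l * (l.factorial : ℝ))) *
    (Polynomial.derivative^[l] ((Polynomial.X ^ 2 - 1) ^ l))

/-- `f` is a Gaussian random spherical eigenfunction of degree `l`: a centred Gaussian random
field on `S²`, with almost surely continuous sample paths and covariance function
`𝔼[f x * f y] = P_l ⟨x, y⟩`. (In particular `𝔼[f x ^ 2] = P_l 1 = 1`; the field is isotropic, and
has the law of `∑ m, a_m Y_m` for a real orthonormal basis `Y_m` of the spherical harmonics of
degree `l` and independent centred Gaussian `a_m` of variance `4 π / (2 l + 1)`.) -/
structure IsGaussianEigenfunction {Ω : Type*} [MeasurableSpace Ω] (l : ℕ)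
    (f : S2 → Ω → ℝ) (P : Measure Ω) : Prop where
  gaussian : IsGaussianProcess f P
  centred : ∀ x : S2, ∫ ω, f x ω ∂P = 0
  covariance : ∀ x y : S2, ∫ ω, f x ω * f y ω ∂P =
    (legendreP l).eval (inner ℝ (x : EuclideanSpace ℝ (Fin 3)) (y : EuclideanSpace ℝ (Fin 3)))
  continuous_paths : ∀ᵐ ω ∂P, Continuous fun x : S2 => f x ω

/-- The statistic `∫_{S²} H_q(f(x)) dx`, where `H_q` is the Hermite polynomial of degree `q` in the
probabilists' normalization (`H_0 = 1`, `H_q' = q H_{q-1}`, `𝔼[H_q(Z)] = 0` for `q ≥ 1` and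
`Z` standard normal). For `f = f_l` this is `h_{l;q}`. -/
def hermiteStat {Ω : Type*} (q : ℕ) (f : S2 → Ω → ℝ) (ω : Ω) : ℝ :=
  ∫ x, Polynomial.aeval (f x ω) (Polynomial.hermite q) ∂surfaceMeasure

end

/-!
Two independent facts are combined.

*The variance.* For a centred Gaussian pair `(X, Y)` with unit variances and covariance `r`, the
variable `Y - r X` is independent of `X`; averaging `H_4 (Y)` over it leaves `r ^ 4 H_4 (X)`, so
`𝔼[H_4 X * H_4 Y] = 24 r ^ 4` (`integral_hermite_four_mul_hermite_four`). Since the paths are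
almost surely continuous, the field is jointly measurable up to a null set
(`aemeasurable_uncurry_of_continuous`), and Fubini's theorem turns the variance into the double
integral over the sphere of `24 P_l ⟪x, y⟫ ^ 4` (`memLp_integral_and_variance`). Archimedes'
hat-box theorem (`integral_sphere_eval_inner`) reduces this to a one-dimensional integral. The
hat-box theorem is proved for monomials, by computing the Gaussian integral of `⟪x, y⟫ ^ k` over
`ℝ³` both in an orthonormal basis containing `y` and in polar coordinates.

*The asymptotics.* With `c = l + 1 / 2`, Legendre's equation says that
`u θ = √(sin θ) P_l (cos θ)` solves `u'' + (c² + 1 / (4 sin² θ)) u = 0`, a harmonic oscillator with a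
perturbation which is controlled as long as `c sin θ ≥ 1`. There the energy `u² + v²`, `v = u' / c`, stays close to its
value `A_l` at `θ = π / 2`, and `u ^ 4` differs from its average `(3 / 8) (u² + v²)²` by the
derivative of a small quantity. Hence `∫ P_l (cos θ) ^ 4 sin θ dθ = ∫ u ^ 4 / sin θ dθ` equals
`(3 / 8) A_l²` times `∫ dθ / sin θ = log l + O (1)`, up to `O (A_l²)`
(`PerturbedOscillation.abs_integral_pow_four_div_sin_sub_le`). The remaining polar cap has
`dt`-length at most `1 / c²`, and `|P_l| ≤ 1` there. Finally `A_l` is explicit, because `P_l 0`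
and `P_l' 0` are multiples of central binomial coefficients, and Wallis' product gives
`l A_l → 2 / π` (`tendsto_mul_equatorAmplitude`); the constant is `(3 / 8) (2 / π)² = 3 / (2 π²)`.
-/

/-! ### Legendre polynomials: differential equation, special values and bound -/

/-- Obtained by differentiating `(X² - 1) w' = 2 l X w`, `w = (X² - 1) ^ l`, repeatedly; `k = l` is
Legendre's equation. -/
lemma rodrigues_iterate_ode (l k : ℕ) :
    ((Polynomial.X ^ 2 - 1 : Polynomial ℝ)) *
        Polynomial.derivative^[k + 2] ((Polynomial.X ^ 2 - 1) ^ l)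
      + Polynomial.C (2 * ((k : ℝ) + 1 - l)) * Polynomial.X *
        Polynomial.derivative^[k + 1] ((Polynomial.X ^ 2 - 1) ^ l)
      + Polynomial.C (((k : ℝ) + 1) * k - 2 * l * (k + 1)) *
        Polynomial.derivative^[k] ((Polynomial.X ^ 2 - 1) ^ l) = 0 := by
  induction k with
  | zero =>
    rcases l with _ | l
    · simp
    have h1 : Polynomial.derivative ((Polynomial.X ^ 2 - 1 : Polynomial ℝ) ^ (l + 1)) =
        Polynomial.C (2 * ((l : ℝ) + 1)) * Polynomial.X * (Polynomial.X ^ 2 - 1) ^ l := by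
      rw [Polynomial.derivative_pow]
      simp only [Polynomial.derivative_sub, Polynomial.derivative_X_pow, Polynomial.derivative_one,
        map_mul, map_add, map_ofNat, map_natCast, map_one, Nat.add_sub_cancel]
      push_cast
      simp
      ring
    have h2 : (Polynomial.X ^ 2 - 1 : Polynomial ℝ) *
        Polynomial.derivative ((Polynomial.X ^ 2 - 1 : Polynomial ℝ) ^ (l + 1)) =
        Polynomial.C (2 * ((l : ℝ) + 1)) * Polynomial.X * (Polynomial.X ^ 2 - 1) ^ (l + 1) := by
      rw [h1]; ring
    have h3 := congrArg Polynomial.derivative h2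
    simp only [Polynomial.derivative_mul, Polynomial.derivative_sub, Polynomial.derivative_X_pow,
      Polynomial.derivative_one, Polynomial.derivative_C, Polynomial.derivative_X] at h3
    simp only [Function.iterate_succ, Function.iterate_zero, Function.comp, id]
    simp only [map_mul, map_sub, map_add, map_ofNat, map_natCast, map_one, Nat.cast_zero] at h3 ⊢
    push_cast at h3 ⊢
    simp at h3 ⊢
    linear_combination h3
  | succ k ih =>
    have h3 := congrArg Polynomial.derivative ih
    simp only [Polynomial.derivative_add, Polynomial.derivative_mul, Polynomial.derivative_sub,
      Polynomial.derivative_X_pow, Polynomial.derivative_one, Polynomial.derivative_C,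
      Polynomial.derivative_X, ← Function.iterate_succ_apply'] at h3
    simp only [map_mul, map_sub, map_add, map_ofNat, map_natCast, map_one] at h3 ⊢
    push_cast at h3 ⊢
    simp at h3 ⊢
    linear_combination h3

/-- Legendre's differential equation. -/
lemma legendreP_ode (l : ℕ) (t : ℝ) :
    (1 - t ^ 2) * (legendreP l).derivative.derivative.eval t
      - 2 * t * (legendreP l).derivative.eval t + l * (l + 1) * (legendreP l).eval t = 0 := by
  have h := congrArg (Polynomial.eval t) (rodrigues_iterate_ode l l)
  simp only [legendreP, Polynomial.derivative_C_mul, ← Function.iterate_succ_apply']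
  simp at h ⊢
  linear_combination (-(1 / (2 ^ l * (l.factorial : ℝ)))) * h

lemma legendreP_eval_one (l : ℕ) : (legendreP l).eval 1 = 1 := by
  have h : (Polynomial.X ^ 2 - 1 : Polynomial ℝ) ^ l =
      (Polynomial.X - Polynomial.C 1) ^ l * (Polynomial.X + Polynomial.C 1) ^ l := by
    rw [← mul_pow]; congr 1; simp; ring
  rw [legendreP, h, Polynomial.iterate_derivative_mul, Polynomial.eval_mul,
    Polynomial.eval_finsetSum, Finset.sum_eq_single 0]
  · rw [Polynomial.eval_smul, Nat.sub_zero, Polynomial.iterate_derivative_X_sub_pow_self]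
    simp
    field_simp
    norm_num
  · intro k hk hk0
    have : k ≤ l := by simpa [Nat.lt_succ_iff] using hk
    rw [Polynomial.iterate_derivative_X_sub_pow]
    have h2 : l - (l - k) ≠ 0 := by omega
    rw [Polynomial.eval_smul, Polynomial.eval_mul, Polynomial.eval_smul, Polynomial.eval_pow]
    simp only [Polynomial.eval_sub, Polynomial.eval_X, Polynomial.eval_C, sub_self, zero_pow h2,
      smul_zero, zero_mul]
  · simp

lemma legendreP_eval_neg (l : ℕ) (t : ℝ) :
    (legendreP l).eval (-t) = (-1) ^ l * (legendreP l).eval t := by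
  have key : ∀ k, (Polynomial.derivative^[k] ((Polynomial.X ^ 2 - 1 : Polynomial ℝ) ^ l)).comp
      (-Polynomial.X) = (-1) ^ k * Polynomial.derivative^[k] ((Polynomial.X ^ 2 - 1) ^ l) := by
    intro k
    induction k with
    | zero => simp
    | succ k ih =>
      generalize (Polynomial.X ^ 2 - 1 : Polynomial ℝ) ^ l = w at ih ⊢
      have h := congrArg Polynomial.derivative ih
      rw [Polynomial.derivative_comp] at h
      have h1 : Polynomial.derivative ((-1 : Polynomial ℝ) ^ k) = 0 := by
        rw [show (-1 : Polynomial ℝ) ^ k = Polynomial.C ((-1) ^ k) by simp]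
        exact Polynomial.derivative_C
      rw [Polynomial.derivative_mul, h1] at h
      simp only [← Function.iterate_succ_apply'] at h
      simp only [Polynomial.derivative_neg, Polynomial.derivative_X, zero_mul, zero_add] at h
      rw [pow_succ, ← Nat.succ_eq_add_one]
      linear_combination -h
  have h := congrArg (Polynomial.eval t) (key l)
  simp only [legendreP]
  simp [Polynomial.eval_comp] at h ⊢
  rw [h]; ring

lemma coeff_X_sq_sub_one_pow (l k : ℕ) :
    ((Polynomial.X ^ 2 - 1 : Polynomial ℝ) ^ l).coeff k =
      if 2 ∣ k then (-1) ^ (l - k / 2) * (l.choose (k / 2) : ℝ) else 0 := by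
  have h : (Polynomial.X ^ 2 - 1 : Polynomial ℝ) ^ l =
      Polynomial.expand ℝ 2 ((Polynomial.X + Polynomial.C (-1)) ^ l) := by
    simp [sub_eq_add_neg]
  rw [h, Polynomial.coeff_expand (by norm_num), Polynomial.coeff_X_add_C_pow]

lemma legendreP_eval_zero (l : ℕ) :
    (legendreP l).eval 0 = 1 / 2 ^ l * ((Polynomial.X ^ 2 - 1 : Polynomial ℝ) ^ l).coeff l := by
  rw [legendreP, Polynomial.eval_C_mul, ← Polynomial.coeff_zero_eq_eval_zero,
    Polynomial.coeff_iterate_derivative]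
  simp [Nat.descFactorial_self]
  field_simp

lemma legendreP_derivative_eval_zero (l : ℕ) :
    (legendreP l).derivative.eval 0 =
      (l + 1) / 2 ^ l * ((Polynomial.X ^ 2 - 1 : Polynomial ℝ) ^ l).coeff (l + 1) := by
  rw [legendreP, Polynomial.derivative_C_mul,
    ← Function.iterate_succ_apply' (f := Polynomial.derivative), Polynomial.eval_C_mul,
    ← Polynomial.coeff_zero_eq_eval_zero,
    Polynomial.coeff_iterate_derivative]
  have h : (l + 1).descFactorial l = (l + 1) * l.factorial := by
    have := Nat.factorial_mul_descFactorial (Nat.le_succ l)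
    simpa [Nat.factorial_succ] using this
  simp [h]
  field_simp

/-- On `[-1, 1]` the Sonin function `P ^ 2 + (1 - t ^ 2) P' ^ 2 / (l (l + 1))` increases away from
the origin, hence is at most its value `1` at `t = 1`. -/
lemma abs_legendreP_eval_le_one (l : ℕ) (hl : 1 ≤ l) {t : ℝ} (h0 : 0 ≤ t) (h1 : t ≤ 1) :
    |(legendreP l).eval t| ≤ 1 := by
  have hl' : (0 : ℝ) < l := by exact_mod_cast hl
  set p := legendreP l with hp
  set S : ℝ → ℝ := fun t => (p.eval t) ^ 2 +
    (1 - t ^ 2) * (p.derivative.eval t) ^ 2 / (l * (l + 1)) with hS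
  have hd : ∀ x : ℝ, HasDerivAt S (2 * x * (p.derivative.eval x) ^ 2 / (l * (l + 1))) x := by
    intro x
    have e1 := p.hasDerivAt x
    have e2 := p.derivative.hasDerivAt x
    have := ((e1.pow 2).add (((((hasDerivAt_id x).pow 2).const_sub 1).mul (e2.pow 2)).div_const
      ((l : ℝ) * (l + 1))))
    refine this.congr_deriv ?_
    have ode := legendreP_ode l x
    rw [← hp] at ode
    simp
    field_simp
    linear_combination (p.derivative.eval x) * ode
  have hmono : MonotoneOn S (Set.Icc 0 1) := by
    apply monotoneOn_of_deriv_nonneg (convex_Icc 0 1)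
    · exact fun x _ => (hd x).continuousAt.continuousWithinAt
    · exact fun x _ => (hd x).differentiableAt.differentiableWithinAt
    · intro x hx
      rw [interior_Icc] at hx
      rw [(hd x).deriv]
      have := hx.1
      positivity
  have h := hmono ⟨h0, h1⟩ ⟨zero_le_one, le_rfl⟩ h1
  simp only [hS, hp, legendreP_eval_one] at h
  have h2 : 0 ≤ (1 - t ^ 2) * ((legendreP l).derivative.eval t) ^ 2 / (l * (l + 1)) := by
    have : 0 ≤ 1 - t ^ 2 := by nlinarith
    positivity
  rw [← sq_le_one_iff_abs_le_one]
  norm_num at h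
  linarith

/-- Wallis' product. -/
lemma tendsto_mul_centralBinom_sq :
    Tendsto (fun n : ℕ => (n : ℝ) * ((n.centralBinom : ℝ) / 4 ^ n) ^ 2) atTop
      (nhds (1 / Real.pi)) := by
  have h : ∀ n : ℕ, (n : ℝ) * ((n.centralBinom : ℝ) / 4 ^ n) ^ 2 =
      ((n : ℝ) / (2 * n + 1)) * (Real.Wallis.W n)⁻¹ := by
    intro n
    rw [Real.Wallis.W_eq_factorial_ratio, Nat.centralBinom_eq_two_mul_choose,
      Nat.cast_choose ℝ (by omega : n ≤ 2 * n)]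
    have : 2 * n - n = n := by omega
    rw [this, pow_mul, show (2 : ℝ) ^ 4 = 4 ^ 2 by norm_num, ← pow_mul, mul_comm 2 n, pow_mul]
    field_simp
  simp_rw [h]
  have h1 : Tendsto (fun n : ℕ => (n : ℝ) / (2 * n + 1)) atTop (nhds (1 / 2)) := by
    have := tendsto_natCast_div_add_atTop (1 / 2 : ℝ)
    have := this.const_mul (1 / 2)
    simp only [mul_one] at this
    refine this.congr fun n => ?_
    field_simp
  have := h1.mul (Real.Wallis.tendsto_W_nhds_pi_div_two.inv₀ (by positivity))
  convert this using 2
  field_simp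

/-- The squared amplitude at `θ = π / 2` of `θ ↦ √(sin θ) P_l (cos θ)`, regarded as a perturbed
oscillation of frequency `l + 1 / 2`. -/
noncomputable def equatorAmplitude (l : ℕ) : ℝ :=
  (legendreP l).eval 0 ^ 2 + ((legendreP l).derivative.eval 0 / (l + 1 / 2)) ^ 2

lemma equatorAmplitude_even (n : ℕ) :
    equatorAmplitude (2 * n) = ((n.centralBinom : ℝ) / 4 ^ n) ^ 2 := by
  have hsq : ∀ m : ℕ, ((-1 : ℝ) ^ m) ^ 2 = 1 := fun m => by rw [← pow_mul, mul_comm, pow_mul]; simp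
  rw [equatorAmplitude, legendreP_eval_zero, legendreP_derivative_eval_zero,
    coeff_X_sq_sub_one_pow, coeff_X_sq_sub_one_pow, if_pos (by omega), if_neg (by omega),
    Nat.centralBinom_eq_two_mul_choose, pow_mul, show (2 : ℝ) ^ 2 = 4 by norm_num]
  simp [mul_pow, div_pow, hsq]
  field_simp

lemma equatorAmplitude_odd (n : ℕ) :
    equatorAmplitude (2 * n + 1) =
      (((n + 1).centralBinom : ℝ) / 4 ^ (n + 1)) ^ 2 * ((2 * n + 2) / (2 * n + 3 / 2)) ^ 2 := by
  have hsq : ∀ m : ℕ, ((-1 : ℝ) ^ m) ^ 2 = 1 := fun m => by rw [← pow_mul, mul_comm, pow_mul]; simp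
  have hc : ((n + 1).centralBinom : ℝ) = 2 * ((2 * n + 1).choose (n + 1) : ℝ) := by
    rw [Nat.centralBinom_eq_two_mul_choose, mul_add, Nat.choose_succ_succ' (2 * n + 1) n,
      Nat.choose_symm_half]
    push_cast; ring
  rw [equatorAmplitude, legendreP_eval_zero, legendreP_derivative_eval_zero,
    coeff_X_sq_sub_one_pow, coeff_X_sq_sub_one_pow, if_neg (by omega), if_pos (by omega), hc,
    show (2 * n + 1 + 1) / 2 = n + 1 by omega, show (4 : ℝ) = 2 ^ 2 by norm_num, ← pow_mul]
  push_cast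
  rw [show (2 * (n : ℝ) + 1 + 1 / 2) = 2 * n + 3 / 2 by ring]
  simp only [mul_pow, div_pow, hsq]
  field_simp
  ring

lemma tendsto_mul_equatorAmplitude :
    Tendsto (fun l : ℕ => (l : ℝ) * equatorAmplitude l) atTop (nhds (2 / Real.pi)) := by
  set c : ℕ → ℝ := fun n => (n : ℝ) * ((n.centralBinom : ℝ) / 4 ^ n) ^ 2 with hc
  -- For odd `l`, `(l + 1) ^ 2 / (l + 1 / 2) ^ 2` enters from `P_l' 0` and the frequency.
  set g : ℕ → ℝ := fun l => if Even l then 2 else 2 * (1 - 1 / (4 * (l + 1 / 2) ^ 2)) with hg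
  have key : ∀ l : ℕ, 1 ≤ l → (l : ℝ) * equatorAmplitude l = g l * c ((l + 1) / 2) := by
    intro l hl
    rcases Nat.even_or_odd' l with ⟨n, rfl | rfl⟩
    · rw [equatorAmplitude_even]
      simp only [hg, hc, even_two_mul, if_true, show (2 * n + 1) / 2 = n by omega]
      push_cast; ring
    · rw [equatorAmplitude_odd]
      have : ¬ Even (2 * n + 1) := by simp
      simp only [hg, hc, this, if_false, show (2 * n + 1 + 1) / 2 = n + 1 by omega]
      push_cast
      rw [show (2 * (n : ℝ) + 1 + 1 / 2) = 2 * n + 3 / 2 by ring]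
      field_simp
      ring
  have hgl : Tendsto g atTop (nhds 2) := by
    have h1 : Tendsto (fun l : ℕ => 2 * (1 - 1 / ((l : ℝ) + 1))) atTop (nhds (2 * (1 - 0))) :=
      (tendsto_one_div_add_atTop_nhds_zero_nat.const_sub 1).const_mul 2
    norm_num at h1
    refine tendsto_of_tendsto_of_tendsto_of_le_of_le
      (by simpa using h1) tendsto_const_nhds (fun l => ?_) (fun l => ?_)
    · have h0 : (0 : ℝ) ≤ l := Nat.cast_nonneg l
      by_cases h : Even l
      · simp only [hg, h, if_true]
        have : 0 ≤ ((l : ℝ) + 1)⁻¹ := by positivity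
        linarith
      · simp only [hg, h, if_false]
        have : 1 / (4 * ((l : ℝ) + 1 / 2) ^ 2) ≤ ((l : ℝ) + 1)⁻¹ := by
          rw [← one_div]
          apply one_div_le_one_div_of_le (by positivity)
          nlinarith
        linarith
    · by_cases h : Even l
      · simp [hg, h]
      · simp only [hg, h, if_false]
        have : 0 ≤ 1 / (4 * ((l : ℝ) + 1 / 2) ^ 2) := by positivity
        linarith
  have hcl : Tendsto (fun l : ℕ => c ((l + 1) / 2)) atTop (nhds (1 / Real.pi)) := by
    refine tendsto_mul_centralBinom_sq.comp ?_
    refine tendsto_atTop_mono (fun l => (by omega : l / 2 ≤ (l + 1) / 2)) ?_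
    exact Nat.tendsto_div_const_atTop (by norm_num)
  have := hgl.mul hcl
  rw [mul_one_div] at this
  refine this.congr' ?_
  filter_upwards [eventually_ge_atTop 1] with l hl
  exact (key l hl).symm

/-! ### Perturbed harmonic oscillations -/

/-- `(u, v)` solves on `(0, π)` the first order system equivalent to
`u'' + (c² + 1 / (4 sin² θ)) u = 0`, where `v = u' / c`. -/
structure PerturbedOscillation (c : ℝ) (u v : ℝ → ℝ) : Prop where
  deriv_u : ∀ θ ∈ Set.Ioo 0 Real.pi, HasDerivAt u (c * v θ) θ
  deriv_v : ∀ θ ∈ Set.Ioo 0 Real.pi,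
    HasDerivAt v (-(c + 1 / (4 * c * Real.sin θ ^ 2)) * u θ) θ

lemma hasDerivAt_cot_div {θ : ℝ} (hθ : Real.sin θ ≠ 0) :
    HasDerivAt (fun θ => Real.cos θ / Real.sin θ) (-(1 / Real.sin θ ^ 2)) θ := by
  refine ((Real.hasDerivAt_cos θ).div (Real.hasDerivAt_sin θ) hθ).congr_deriv ?_
  have := Real.sin_sq_add_cos_sq θ
  field_simp
  linarith

namespace PerturbedOscillation
variable {c : ℝ} {u v : ℝ → ℝ}

lemma hasDerivAt_energy (h : PerturbedOscillation c u v) {θ : ℝ}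
    (hθ : θ ∈ Set.Ioo 0 Real.pi) :
    HasDerivAt (fun θ => u θ ^ 2 + v θ ^ 2) (-(1 / (2 * c * Real.sin θ ^ 2)) * (u θ * v θ)) θ := by
  refine (((h.deriv_u θ hθ).pow 2).add ((h.deriv_v θ hθ).pow 2)).congr_deriv ?_
  have := (Real.sin_pos_of_mem_Ioo hθ).ne'
  simp only [Nat.cast_ofNat, Nat.add_one_sub_one, pow_one]
  have e : 1 / (4 * c * Real.sin θ ^ 2) * 2 = 1 / (2 * c * Real.sin θ ^ 2) := by
    rw [show 4 * c * Real.sin θ ^ 2 = 2 * (2 * c * Real.sin θ ^ 2) by ring, ← div_div]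
    ring
  rw [← e]; ring

/-- The logarithm of the energy `u ^ 2 + v ^ 2` has slope at most `1 / (4 c sin ^ 2)`, which is
integrated by the cotangent. -/
lemma energy_mul_exp_bounds (h : PerturbedOscillation c u v) (hc : 0 < c) {θ : ℝ}
    (h0 : 0 < θ) (h1 : θ ≤ Real.pi / 2) :
    (u θ ^ 2 + v θ ^ 2) * Real.exp (-(Real.cos θ / Real.sin θ / (4 * c))) ≤
        u (Real.pi / 2) ^ 2 + v (Real.pi / 2) ^ 2 ∧
      u (Real.pi / 2) ^ 2 + v (Real.pi / 2) ^ 2 ≤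
        (u θ ^ 2 + v θ ^ 2) * Real.exp (Real.cos θ / Real.sin θ / (4 * c)) := by
  have hpi := Real.pi_pos
  have hsub : ∀ x ∈ Set.Icc θ (Real.pi / 2), x ∈ Set.Ioo 0 Real.pi := fun x hx =>
    ⟨h0.trans_le hx.1, by linarith [hx.2]⟩
  have hd : ∀ s : ℝ, ∀ x ∈ Set.Icc θ (Real.pi / 2),
      HasDerivAt (fun x => (u x ^ 2 + v x ^ 2) *
        Real.exp (s * (Real.cos x / Real.sin x / (4 * c))))
        (-(1 / (4 * c * Real.sin x ^ 2)) * (2 * (u x * v x) + s * (u x ^ 2 + v x ^ 2)) *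
          Real.exp (s * (Real.cos x / Real.sin x / (4 * c)))) x := by
    intro s x hx
    have hs := (Real.sin_pos_of_mem_Ioo (hsub x hx)).ne'
    refine ((h.hasDerivAt_energy (hsub x hx)).mul
      ((((hasDerivAt_cot_div hs).div_const (4 * c)).const_mul s).exp)).congr_deriv ?_
    field_simp
    ring
  have hq : ∀ x ∈ Set.Icc θ (Real.pi / 2), 0 ≤ 1 / (4 * c * Real.sin x ^ 2) := by
    intro x hx
    positivity
  constructor
  · have hmono : MonotoneOn (fun x => (u x ^ 2 + v x ^ 2) *
        Real.exp (-1 * (Real.cos x / Real.sin x / (4 * c)))) (Set.Icc θ (Real.pi / 2)) := by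
      apply monotoneOn_of_deriv_nonneg (convex_Icc _ _)
      · exact fun x hx => (hd _ x hx).continuousAt.continuousWithinAt
      · exact fun x hx => (hd _ x (interior_subset hx)).differentiableAt.differentiableWithinAt
      · intro x hx
        have hx := interior_subset hx
        rw [(hd _ x hx).deriv]
        have := hq x hx
        have h3 : 0 ≤ u x ^ 2 + v x ^ 2 - 2 * (u x * v x) := by nlinarith [sq_nonneg (u x - v x)]
        have := mul_nonneg (mul_nonneg this h3)
          (Real.exp_pos (-1 * (Real.cos x / Real.sin x / (4 * c)))).le
        nlinarith
    have := hmono ⟨le_rfl, h1⟩ ⟨h1, le_rfl⟩ h1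
    simpa using this
  · have hmono : AntitoneOn (fun x => (u x ^ 2 + v x ^ 2) *
        Real.exp (1 * (Real.cos x / Real.sin x / (4 * c)))) (Set.Icc θ (Real.pi / 2)) := by
      apply antitoneOn_of_deriv_nonpos (convex_Icc _ _)
      · exact fun x hx => (hd _ x hx).continuousAt.continuousWithinAt
      · exact fun x hx => (hd _ x (interior_subset hx)).differentiableAt.differentiableWithinAt
      · intro x hx
        have hx := interior_subset hx
        rw [(hd _ x hx).deriv]
        have := hq x hx
        have h3 : 0 ≤ u x ^ 2 + v x ^ 2 + 2 * (u x * v x) := by nlinarith [sq_nonneg (u x + v x)]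
        have := mul_nonneg (mul_nonneg this h3)
          (Real.exp_pos (1 * (Real.cos x / Real.sin x / (4 * c)))).le
        nlinarith
    have := hmono ⟨le_rfl, h1⟩ ⟨h1, le_rfl⟩ h1
    simpa using this

/-- In the range `c sin θ ≥ 1` the energy is within a factor `1 + O (cot θ / c)` of its value at the
equator. -/
lemma abs_energy_sq_sub_le (h : PerturbedOscillation c u v) (hc : 0 < c) {θ : ℝ}
    (h0 : 0 < θ) (h1 : θ ≤ Real.pi / 2) (hs : 1 ≤ c * Real.sin θ) :
    |(u θ ^ 2 + v θ ^ 2) ^ 2 - (u (Real.pi / 2) ^ 2 + v (Real.pi / 2) ^ 2) ^ 2| ≤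
      (u (Real.pi / 2) ^ 2 + v (Real.pi / 2) ^ 2) ^ 2 * (Real.cos θ / (c * Real.sin θ)) := by
  obtain ⟨hA, hB⟩ := h.energy_mul_exp_bounds hc h0 h1
  set E := u θ ^ 2 + v θ ^ 2
  set E₀ := u (Real.pi / 2) ^ 2 + v (Real.pi / 2) ^ 2
  set k := Real.cos θ / Real.sin θ / (4 * c) with hk
  have hE : 0 ≤ E := by positivity
  have hE₀ : 0 ≤ E₀ := by positivity
  have hsin : 0 < Real.sin θ := Real.sin_pos_of_pos_of_lt_pi h0 (by linarith [Real.pi_pos])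
  have hcos : 0 ≤ Real.cos θ := Real.cos_nonneg_of_mem_Icc ⟨by linarith [Real.pi_pos], h1⟩
  have hk4 : Real.cos θ / (c * Real.sin θ) = 4 * k := by rw [hk]; field_simp
  have hk0 : 0 ≤ k := by positivity
  have hk1 : 4 * k ≤ 1 := by
    rw [← hk4, div_le_one (by positivity)]
    exact (Real.cos_le_one θ).trans hs
  rw [hk4]
  have hA' : E ≤ E₀ * Real.exp k := by
    have := mul_le_mul_of_nonneg_right hA (Real.exp_pos k).le
    rwa [mul_assoc, ← Real.exp_add, neg_add_cancel, Real.exp_zero, mul_one] at this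
  have hB' : E₀ * Real.exp (-k) ≤ E := by
    have := mul_le_mul_of_nonneg_right hB (Real.exp_pos (-k)).le
    rwa [mul_assoc E, ← Real.exp_add, add_neg_cancel, Real.exp_zero, mul_one] at this
  have e1 : E ^ 2 ≤ E₀ ^ 2 * Real.exp (2 * k) := by
    calc E ^ 2 ≤ (E₀ * Real.exp k) ^ 2 := by gcongr
      _ = _ := by rw [mul_pow, ← Real.exp_nat_mul]; norm_num
  have e2 : E₀ ^ 2 * Real.exp (-(2 * k)) ≤ E ^ 2 := by
    calc E₀ ^ 2 * Real.exp (-(2 * k)) = (E₀ * Real.exp (-k)) ^ 2 := by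
          rw [mul_pow, ← Real.exp_nat_mul]; norm_num
      _ ≤ _ := by gcongr
  have f1 : Real.exp (2 * k) - 1 ≤ 4 * k := by
    have := Real.abs_exp_sub_one_le (x := 2 * k) (by rw [abs_of_nonneg (by positivity)]; linarith)
    rw [abs_of_nonneg (by positivity : 0 ≤ 2 * k)] at this
    linarith [(abs_le.1 this).2]
  have f2 : 1 - 2 * k ≤ Real.exp (-(2 * k)) := by linarith [Real.add_one_le_exp (-(2 * k))]
  have hE2 : 0 ≤ E₀ ^ 2 := by positivity
  rw [abs_le]
  constructor <;> nlinarith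

/-- Along the unperturbed flow `u' = c v`, `v' = -c u` the derivative of
`-u v (5 u² + 3 v²) / (8 c)` is `u ^ 4 - (3 / 8) (u² + v²)²`, the oscillating part of `u ^ 4`. The
last two summands come from the perturbation and from the weight `1 / sin`. -/
lemma hasDerivAt_oscillation (h : PerturbedOscillation c u v) (hc : 0 < c) {θ : ℝ}
    (hθ : θ ∈ Set.Ioo 0 Real.pi) :
    HasDerivAt (fun θ => -(u θ * v θ * (5 * u θ ^ 2 + 3 * v θ ^ 2)) / (8 * c * Real.sin θ))
      ((u θ ^ 4 - 3 / 8 * (u θ ^ 2 + v θ ^ 2) ^ 2) / Real.sin θ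
        + u θ ^ 2 * (5 * u θ ^ 2 + 9 * v θ ^ 2) / (32 * c ^ 2 * Real.sin θ ^ 3)
        + u θ * v θ * (5 * u θ ^ 2 + 3 * v θ ^ 2) * Real.cos θ / (8 * c * Real.sin θ ^ 2)) θ := by
  have hs := (Real.sin_pos_of_mem_Ioo hθ).ne'
  have du := h.deriv_u θ hθ
  have dv := h.deriv_v θ hθ
  refine ((((du.mul dv).mul (((du.pow 2).const_mul 5).add ((dv.pow 2).const_mul 3))).neg.div
    ((Real.hasDerivAt_sin θ).const_mul (8 * c)) (by positivity))).congr_deriv ?_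
  simp
  field_simp
  ring

/-- The integrand minus its mean, minus the derivative computed in `hasDerivAt_oscillation`, is
dominated by an integrable multiple of `1 / sin²`. -/
lemma abs_pow_four_sub_deriv_le (h : PerturbedOscillation c u v) (hc : 0 < c) {θ : ℝ}
    (h0 : 0 < θ) (h1 : θ ≤ Real.pi / 2) (hs : 1 ≤ c * Real.sin θ) :
    |(u θ ^ 4 - 3 / 8 * (u (Real.pi / 2) ^ 2 + v (Real.pi / 2) ^ 2) ^ 2) / Real.sin θ -
        ((u θ ^ 4 - 3 / 8 * (u θ ^ 2 + v θ ^ 2) ^ 2) / Real.sin θ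
        + u θ ^ 2 * (5 * u θ ^ 2 + 9 * v θ ^ 2) / (32 * c ^ 2 * Real.sin θ ^ 3)
        + u θ * v θ * (5 * u θ ^ 2 + 3 * v θ ^ 2) * Real.cos θ / (8 * c * Real.sin θ ^ 2))| ≤
      3 * (u (Real.pi / 2) ^ 2 + v (Real.pi / 2) ^ 2) ^ 2 / c * (1 / Real.sin θ ^ 2) := by
  have hE := h.abs_energy_sq_sub_le hc h0 h1 hs
  set U := u θ
  set V := v θ
  set E₀ := u (Real.pi / 2) ^ 2 + v (Real.pi / 2) ^ 2
  set s := Real.sin θ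
  have hsin : 0 < s := Real.sin_pos_of_pos_of_lt_pi h0 (by linarith [Real.pi_pos])
  have hcos : 0 ≤ Real.cos θ := Real.cos_nonneg_of_mem_Icc ⟨by linarith [Real.pi_pos], h1⟩
  have hcos1 := Real.cos_le_one θ
  have hE2 : 0 ≤ E₀ ^ 2 := by positivity
  have hE1 : |(U ^ 2 + V ^ 2) ^ 2 - E₀ ^ 2| ≤ E₀ ^ 2 / (c * s) := by
    refine hE.trans ?_
    rw [div_eq_mul_one_div (E₀ ^ 2)]
    gcongr
  have hEle : (U ^ 2 + V ^ 2) ^ 2 ≤ 2 * E₀ ^ 2 := by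
    have : E₀ ^ 2 / (c * s) ≤ E₀ ^ 2 := div_le_self hE2 hs
    linarith [(abs_le.1 hE1).2]
  have t1 : |3 / 8 * ((U ^ 2 + V ^ 2) ^ 2 - E₀ ^ 2) / s| ≤ 3 / 8 * (E₀ ^ 2 / (c * s)) / s := by
    rw [abs_div, abs_mul, abs_of_pos hsin, abs_of_pos (by norm_num : (0 : ℝ) < 3 / 8)]
    gcongr
  have t2 : |U ^ 2 * (5 * U ^ 2 + 9 * V ^ 2) / (32 * c ^ 2 * s ^ 3)| ≤
      9 * (2 * E₀ ^ 2) / (32 * (c * s * 1 * s)) := by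
    rw [abs_of_nonneg (by positivity)]
    have e : 32 * c ^ 2 * s ^ 3 = 32 * (c * s * (c * s) * s) := by ring
    rw [e]
    have num : U ^ 2 * (5 * U ^ 2 + 9 * V ^ 2) ≤ 9 * (2 * E₀ ^ 2) := by
      nlinarith [sq_nonneg U, sq_nonneg V, mul_nonneg (sq_nonneg U) (sq_nonneg V)]
    exact div_le_div₀ (by positivity) num (by positivity) (by gcongr)
  have t3 : |U * V * (5 * U ^ 2 + 3 * V ^ 2) * Real.cos θ / (8 * c * s ^ 2)| ≤
      5 * (2 * E₀ ^ 2) / (8 * c * s ^ 2) := by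
    rw [abs_div, abs_of_pos (by positivity : 0 < 8 * c * s ^ 2)]
    gcongr
    rw [abs_mul, abs_of_nonneg hcos, abs_mul,
      abs_of_nonneg (by positivity : 0 ≤ 5 * U ^ 2 + 3 * V ^ 2)]
    have : |U * V| ≤ U ^ 2 + V ^ 2 := by
      rw [abs_le]; constructor <;> nlinarith [sq_nonneg (U + V), sq_nonneg (U - V)]
    calc |U * V| * (5 * U ^ 2 + 3 * V ^ 2) * Real.cos θ
        ≤ (U ^ 2 + V ^ 2) * (5 * (U ^ 2 + V ^ 2)) * 1 := by
          gcongr; nlinarith [sq_nonneg V]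
      _ ≤ _ := by nlinarith
  have hsum : (U ^ 4 - 3 / 8 * E₀ ^ 2) / s -
        ((U ^ 4 - 3 / 8 * (U ^ 2 + V ^ 2) ^ 2) / s
        + U ^ 2 * (5 * U ^ 2 + 9 * V ^ 2) / (32 * c ^ 2 * s ^ 3)
        + U * V * (5 * U ^ 2 + 3 * V ^ 2) * Real.cos θ / (8 * c * s ^ 2)) =
      3 / 8 * ((U ^ 2 + V ^ 2) ^ 2 - E₀ ^ 2) / s
        - U ^ 2 * (5 * U ^ 2 + 9 * V ^ 2) / (32 * c ^ 2 * s ^ 3)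
        - U * V * (5 * U ^ 2 + 3 * V ^ 2) * Real.cos θ / (8 * c * s ^ 2) := by ring
  rw [hsum]
  have hfin : 3 / 8 * (E₀ ^ 2 / (c * s)) / s + 9 * (2 * E₀ ^ 2) / (32 * (c * s * 1 * s)) +
      5 * (2 * E₀ ^ 2) / (8 * c * s ^ 2) ≤ 3 * E₀ ^ 2 / c * (1 / s ^ 2) := by
    have : 3 / 8 * (E₀ ^ 2 / (c * s)) / s + 9 * (2 * E₀ ^ 2) / (32 * (c * s * 1 * s)) +
      5 * (2 * E₀ ^ 2) / (8 * c * s ^ 2) = (35 / 16) * (E₀ ^ 2 / (c * s ^ 2)) := by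
      field_simp; ring
    rw [this]
    have e : 3 * E₀ ^ 2 / c * (1 / s ^ 2) = 3 * (E₀ ^ 2 / (c * s ^ 2)) := by field_simp
    rw [e]
    have : 0 ≤ E₀ ^ 2 / (c * s ^ 2) := by positivity
    linarith
  rw [abs_le] at t1 t2 t3 ⊢
  constructor <;> linarith [t1.1, t1.2, t2.1, t2.2, t3.1, t3.2]

lemma abs_oscillation_le (h : PerturbedOscillation c u v) (hc : 0 < c) {θ : ℝ}
    (h0 : 0 < θ) (h1 : θ ≤ Real.pi / 2) (hs : 1 ≤ c * Real.sin θ) :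
    |-(u θ * v θ * (5 * u θ ^ 2 + 3 * v θ ^ 2)) / (8 * c * Real.sin θ)| ≤
      2 * (u (Real.pi / 2) ^ 2 + v (Real.pi / 2) ^ 2) ^ 2 := by
  have hE := h.abs_energy_sq_sub_le hc h0 h1 hs
  set U := u θ
  set V := v θ
  set E₀ := u (Real.pi / 2) ^ 2 + v (Real.pi / 2) ^ 2
  set s := Real.sin θ
  have hsin : 0 < s := Real.sin_pos_of_pos_of_lt_pi h0 (by linarith [Real.pi_pos])
  have hcos1 := Real.cos_le_one θ
  have hE2 : 0 ≤ E₀ ^ 2 := by positivity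
  have hEle : (U ^ 2 + V ^ 2) ^ 2 ≤ 2 * E₀ ^ 2 := by
    have : Real.cos θ / (c * s) ≤ 1 := by
      rw [div_le_one (by positivity)]; linarith
    nlinarith [(abs_le.1 hE).2]
  have : |U * V| ≤ U ^ 2 + V ^ 2 := by
    rw [abs_le]; constructor <;> nlinarith [sq_nonneg (U + V), sq_nonneg (U - V)]
  rw [abs_div, abs_of_pos (by positivity : 0 < 8 * c * s), abs_neg, abs_mul,
    abs_of_nonneg (by positivity : 0 ≤ 5 * U ^ 2 + 3 * V ^ 2), div_le_iff₀ (by positivity)]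
  calc |U * V| * (5 * U ^ 2 + 3 * V ^ 2) ≤ (U ^ 2 + V ^ 2) * (5 * (U ^ 2 + V ^ 2)) := by
          gcongr; nlinarith [sq_nonneg V]
      _ ≤ 2 * E₀ ^ 2 * (8 * 1) := by nlinarith
      _ ≤ 2 * E₀ ^ 2 * (8 * (c * s)) := by gcongr
      _ = _ := by ring

lemma integral_one_div_sin_sq {a : ℝ} (h0 : 0 < a) (h1 : a ≤ Real.pi / 2) :
    ∫ θ in a..(Real.pi / 2), 1 / Real.sin θ ^ 2 = Real.cos a / Real.sin a := by
  have hpi := Real.pi_pos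
  have hs : ∀ x ∈ Set.uIcc a (Real.pi / 2), Real.sin x ≠ 0 := by
    intro x hx
    rw [Set.uIcc_of_le h1] at hx
    exact (Real.sin_pos_of_pos_of_lt_pi (h0.trans_le hx.1) (by linarith [hx.2])).ne'
  rw [intervalIntegral.integral_eq_sub_of_hasDerivAt
    (f := fun θ => -(Real.cos θ / Real.sin θ))]
  · simp
  · intro x hx
    exact (hasDerivAt_cot_div (hs x hx)).neg.congr_deriv (by simp)
  · apply ContinuousOn.intervalIntegrable
    exact continuousOn_const.div (Real.continuous_sin.continuousOn.pow 2)
      fun x hx => pow_ne_zero _ (hs x hx)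

lemma integral_one_div_sin {a : ℝ} (h0 : 0 < a) (h1 : a ≤ Real.pi / 2) :
    ∫ θ in a..(Real.pi / 2), 1 / Real.sin θ =
      Real.log (1 + Real.cos a) - Real.log (Real.sin a) := by
  have hpi := Real.pi_pos
  have hs : ∀ x ∈ Set.uIcc a (Real.pi / 2), 0 < Real.sin x := by
    intro x hx
    rw [Set.uIcc_of_le h1] at hx
    exact (Real.sin_pos_of_pos_of_lt_pi (h0.trans_le hx.1) (by linarith [hx.2]))
  have hco : ∀ x ∈ Set.uIcc a (Real.pi / 2), 0 < 1 + Real.cos x := by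
    intro x hx
    rw [Set.uIcc_of_le h1] at hx
    have := Real.cos_nonneg_of_mem_Icc (x := x) ⟨by linarith [hx.1], hx.2⟩
    linarith
  rw [intervalIntegral.integral_eq_sub_of_hasDerivAt
    (f := fun θ => Real.log (Real.sin θ) - Real.log (1 + Real.cos θ))]
  · simp
  · intro x hx
    have h1 := (hs x hx).ne'
    have h2 := (hco x hx).ne'
    refine (((Real.hasDerivAt_sin x).log h1).sub
      (((Real.hasDerivAt_cos x).const_add 1).log h2)).congr_deriv ?_
    have := Real.sin_sq_add_cos_sq x
    field_simp
    linarith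
  · apply ContinuousOn.intervalIntegrable
    exact continuousOn_const.div (Real.continuous_sin.continuousOn)
      fun x hx => (hs x hx).ne'

/-- The fourth power of the oscillation, weighted by `1 / sin`, has mean `3 / 8` of the squared
energy; the bracket on the left is `∫ dθ / sin θ` over `[a, π / 2]`. -/
theorem abs_integral_pow_four_div_sin_sub_le (h : PerturbedOscillation c u v) (hc : 0 < c) {a : ℝ}
    (h0 : 0 < a) (h1 : a ≤ Real.pi / 2) (hs : 1 ≤ c * Real.sin a) :
    |(∫ θ in a..(Real.pi / 2), u θ ^ 4 / Real.sin θ) -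
      3 / 8 * (u (Real.pi / 2) ^ 2 + v (Real.pi / 2) ^ 2) ^ 2 *
        (Real.log (1 + Real.cos a) - Real.log (Real.sin a))| ≤
      7 * (u (Real.pi / 2) ^ 2 + v (Real.pi / 2) ^ 2) ^ 2 := by
  have hpi := Real.pi_pos
  have hmem : ∀ x ∈ Set.uIcc a (Real.pi / 2), x ∈ Set.Ioo 0 Real.pi := by
    intro x hx
    rw [Set.uIcc_of_le h1] at hx
    exact ⟨h0.trans_le hx.1, by linarith [hx.2]⟩
  have hsin : ∀ x ∈ Set.uIcc a (Real.pi / 2), 0 < Real.sin x :=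
    fun x hx => Real.sin_pos_of_mem_Ioo (hmem x hx)
  have hcs : ∀ x ∈ Set.uIcc a (Real.pi / 2), 1 ≤ c * Real.sin x := by
    intro x hx
    rw [Set.uIcc_of_le h1] at hx
    refine hs.trans ?_
    gcongr
    exact Real.sin_le_sin_of_le_of_le_pi_div_two (by linarith) hx.2 hx.1
  have cu : ContinuousOn u (Set.uIcc a (Real.pi / 2)) :=
    fun x hx => (h.deriv_u x (hmem x hx)).continuousAt.continuousWithinAt
  have cv : ContinuousOn v (Set.uIcc a (Real.pi / 2)) :=
    fun x hx => (h.deriv_v x (hmem x hx)).continuousAt.continuousWithinAt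
  have cs : ContinuousOn Real.sin (Set.uIcc a (Real.pi / 2)) := Real.continuous_sin.continuousOn
  have cc : ContinuousOn Real.cos (Set.uIcc a (Real.pi / 2)) := Real.continuous_cos.continuousOn
  set E₀ := u (Real.pi / 2) ^ 2 + v (Real.pi / 2) ^ 2 with hE₀
  set D : ℝ → ℝ := fun θ => (u θ ^ 4 - 3 / 8 * (u θ ^ 2 + v θ ^ 2) ^ 2) / Real.sin θ
        + u θ ^ 2 * (5 * u θ ^ 2 + 9 * v θ ^ 2) / (32 * c ^ 2 * Real.sin θ ^ 3)
        + u θ * v θ * (5 * u θ ^ 2 + 3 * v θ ^ 2) * Real.cos θ / (8 * c * Real.sin θ ^ 2) with hD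
  have iD : IntervalIntegrable D volume a (Real.pi / 2) := by
    apply ContinuousOn.intervalIntegrable
    have n1 : ∀ x ∈ Set.uIcc a (Real.pi / 2), Real.sin x ≠ 0 := fun x hx => (hsin x hx).ne'
    have n2 : ∀ x ∈ Set.uIcc a (Real.pi / 2), 32 * c ^ 2 * Real.sin x ^ 3 ≠ 0 :=
      fun x hx => by have := hsin x hx; positivity
    have n3 : ∀ x ∈ Set.uIcc a (Real.pi / 2), 8 * c * Real.sin x ^ 2 ≠ 0 :=
      fun x hx => by have := hsin x hx; positivity
    fun_prop (disch := assumption)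
  have i1 : IntervalIntegrable (fun θ => u θ ^ 4 / Real.sin θ) volume a (Real.pi / 2) :=
    ((cu.pow 4).div cs fun x hx => (hsin x hx).ne').intervalIntegrable
  have i2 : IntervalIntegrable (fun θ => 1 / Real.sin θ) volume a (Real.pi / 2) :=
    (continuousOn_const.div cs fun x hx => (hsin x hx).ne').intervalIntegrable
  have i3 : IntervalIntegrable (fun θ => 1 / Real.sin θ ^ 2) volume a (Real.pi / 2) :=
    (continuousOn_const.div (cs.pow 2) fun x hx => pow_ne_zero _ (hsin x hx).ne').intervalIntegrable
  have hFTC := intervalIntegral.integral_eq_sub_of_hasDerivAt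
    (fun x hx => h.hasDerivAt_oscillation hc (hmem x hx)) iD
  have b1 := h.abs_oscillation_le hc h0 h1 hs
  have b2 := h.abs_oscillation_le hc (by positivity : 0 < Real.pi / 2) le_rfl
    (hcs _ Set.right_mem_uIcc)
  rw [← hE₀] at b1 b2
  have hrem : |∫ θ in a..(Real.pi / 2),
      ((u θ ^ 4 / Real.sin θ - 3 / 8 * E₀ ^ 2 * (1 / Real.sin θ)) - D θ)| ≤
      ∫ θ in a..(Real.pi / 2), 3 * E₀ ^ 2 / c * (1 / Real.sin θ ^ 2) := by
    rw [← Real.norm_eq_abs]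
    refine intervalIntegral.norm_integral_le_of_norm_le h1 (Eventually.of_forall fun x hx => ?_)
      (i3.const_mul _)
    have hx' : x ∈ Set.uIcc a (Real.pi / 2) := by
      rw [Set.uIcc_of_le h1]; exact Set.Ioc_subset_Icc_self hx
    have := h.abs_pow_four_sub_deriv_le hc (hmem x hx').1 hx.2 (hcs x hx')
    rw [Real.norm_eq_abs]
    convert this using 3
    ring
  rw [intervalIntegral.integral_sub (i1.sub (i2.const_mul _)) iD,
    intervalIntegral.integral_sub i1 (i2.const_mul _), intervalIntegral.integral_const_mul,
    intervalIntegral.integral_const_mul, integral_one_div_sin h0 h1,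
    integral_one_div_sin_sq h0 h1, hFTC] at hrem
  have hb : 3 * E₀ ^ 2 / c * (Real.cos a / Real.sin a) ≤ 3 * E₀ ^ 2 := by
    have e : 3 * E₀ ^ 2 / c * (Real.cos a / Real.sin a) =
      3 * E₀ ^ 2 * (Real.cos a / (c * Real.sin a)) := by field_simp
    rw [e]
    apply mul_le_of_le_one_right (by positivity)
    rw [div_le_one (by linarith)]
    linarith [Real.cos_le_one a]
  have hrem := hrem.trans hb
  rw [abs_le] at b1 b2 hrem ⊢
  constructor <;> linarith [b1.1, b1.2, b2.1, b2.2, hrem.1, hrem.2]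

end PerturbedOscillation

/-! ### Asymptotics of the fourth moment of Legendre polynomials -/

/-- Liouville's normal form of Legendre's equation in the variable `t = cos θ`. -/
lemma legendreP_perturbedOscillation (l : ℕ) :
    PerturbedOscillation ((l : ℝ) + 1 / 2)
      (fun θ => √(Real.sin θ) * (legendreP l).eval (Real.cos θ))
      (fun θ => (Real.cos θ / (2 * √(Real.sin θ)) * (legendreP l).eval (Real.cos θ) -
        √(Real.sin θ) * Real.sin θ * (legendreP l).derivative.eval (Real.cos θ)) /
          ((l : ℝ) + 1 / 2)) := by
  set p := legendreP l with hp
  have hc : (0 : ℝ) < (l : ℝ) + 1 / 2 := by positivity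
  have hP : ∀ θ, HasDerivAt (fun θ => p.eval (Real.cos θ))
      (p.derivative.eval (Real.cos θ) * (-Real.sin θ)) θ := fun θ =>
    (p.hasDerivAt (Real.cos θ)).comp θ (Real.hasDerivAt_cos θ)
  have hP' : ∀ θ, HasDerivAt (fun θ => p.derivative.eval (Real.cos θ))
      (p.derivative.derivative.eval (Real.cos θ) * (-Real.sin θ)) θ := fun θ =>
    (p.derivative.hasDerivAt (Real.cos θ)).comp θ (Real.hasDerivAt_cos θ)
  constructor
  · intro θ hθ
    have hs := Real.sin_pos_of_mem_Ioo hθ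
    refine (((Real.hasDerivAt_sin θ).sqrt hs.ne').mul (hP θ)).congr_deriv ?_
    field_simp
    ring
  · intro θ hθ
    have hs := Real.sin_pos_of_mem_Ioo hθ
    have hq : 0 < √(Real.sin θ) := Real.sqrt_pos.2 hs
    have hsq : √(Real.sin θ) ^ 2 = Real.sin θ := Real.sq_sqrt hs.le
    have dq := (Real.hasDerivAt_sin θ).sqrt hs.ne'
    have ode := legendreP_ode l (Real.cos θ)
    rw [← hp] at ode
    have htr := Real.sin_sq_add_cos_sq θ
    refine (((((Real.hasDerivAt_cos θ).div (dq.const_mul 2) (by positivity)).mul (hP θ)).sub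
      ((dq.mul (Real.hasDerivAt_sin θ)).mul (hP' θ))).div_const _).congr_deriv ?_
    simp only [Pi.mul_apply, Pi.div_apply]
    generalize p.eval (Real.cos θ) = A at *
    generalize p.derivative.eval (Real.cos θ) = B at *
    generalize p.derivative.derivative.eval (Real.cos θ) = D at *
    generalize Real.cos θ = x at *
    generalize √(Real.sin θ) = q at *
    generalize Real.sin θ = s at *
    subst hsq
    field_simp
    have hx : x ^ 2 = 1 - q ^ 4 := by linear_combination htr
    have hode : q ^ 4 * D = 2 * x * B - l * (l + 1) * A := by
      linear_combination ode + D * htr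
    linear_combination 16 * q ^ 4 * hode - 4 * A * hx

/-- The integral is split at `t = cos a` with `sin a = 1 / (l + 1 / 2)`, the end of the range in
which the oscillation estimate holds. -/
lemma abs_integral_legendreP_pow_four_sub_le (l : ℕ) (hl : 1 ≤ l) :
    |(∫ t in (0 : ℝ)..1, (legendreP l).eval t ^ 4) -
      3 / 8 * equatorAmplitude l ^ 2 * Real.log l| ≤
      8 * equatorAmplitude l ^ 2 + 1 / (l : ℝ) ^ 2 := by
  have hpi := Real.pi_pos
  have hl' : (1 : ℝ) ≤ l := by exact_mod_cast hl
  set c : ℝ := (l : ℝ) + 1 / 2 with hc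
  have hc1 : 1 < c := by rw [hc]; linarith
  have hc0 : 0 < c := by linarith
  set a : ℝ := Real.arcsin (1 / c) with ha
  have hinv1 : 1 / c ≤ 1 := by rw [div_le_one hc0]; exact hc1.le
  have hinv0 : 0 < 1 / c := by positivity
  have hsa : Real.sin a = 1 / c := Real.sin_arcsin (by linarith) hinv1
  have ha0 : 0 < a := Real.arcsin_pos.2 hinv0
  have ha1 : a ≤ Real.pi / 2 := Real.arcsin_le_pi_div_two _
  have hcos0 : 0 ≤ Real.cos a := Real.cos_arcsin_nonneg _
  have hcos1 : Real.cos a ≤ 1 := Real.cos_le_one a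
  have hosc := legendreP_perturbedOscillation l
  have main := hosc.abs_integral_pow_four_div_sin_sub_le hc0 ha0 ha1
    (by rw [hsa, mul_one_div, div_self hc0.ne'])
  have hE : (√(Real.sin (Real.pi / 2)) * (legendreP l).eval (Real.cos (Real.pi / 2))) ^ 2 +
      ((Real.cos (Real.pi / 2) / (2 * √(Real.sin (Real.pi / 2))) *
        (legendreP l).eval (Real.cos (Real.pi / 2)) -
        √(Real.sin (Real.pi / 2)) * Real.sin (Real.pi / 2) *
          (legendreP l).derivative.eval (Real.cos (Real.pi / 2))) / c) ^ 2 =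
      equatorAmplitude l := by
    simp [equatorAmplitude, hc, neg_div]
  rw [hE, hsa, Real.log_div one_ne_zero hc0.ne', Real.log_one, zero_sub, sub_neg_eq_add] at main
  have cont : Continuous fun t : ℝ => (legendreP l).eval t ^ 4 :=
    (legendreP l).continuous.pow 4
  have hsub : ∫ θ in a..(Real.pi / 2),
      (√(Real.sin θ) * (legendreP l).eval (Real.cos θ)) ^ 4 / Real.sin θ =
      ∫ t in (0 : ℝ)..(Real.cos a), (legendreP l).eval t ^ 4 := by
    have h1 := intervalIntegral.integral_comp_mul_deriv (a := a) (b := Real.pi / 2)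
      (f := Real.cos) (f' := fun x => -Real.sin x) (g := fun t => (legendreP l).eval t ^ 4)
      (fun x _ => Real.hasDerivAt_cos x) (Real.continuous_sin.neg.continuousOn) cont
    rw [Real.cos_pi_div_two, intervalIntegral.integral_symm 0 (Real.cos a)] at h1
    rw [← neg_eq_iff_eq_neg.2 h1, ← intervalIntegral.integral_neg]
    refine intervalIntegral.integral_congr fun x hx => ?_
    rw [Set.uIcc_of_le ha1] at hx
    have hs : 0 < Real.sin x :=
      Real.sin_pos_of_pos_of_lt_pi (ha0.trans_le hx.1) (by linarith [hx.2])
    have h4 : √(Real.sin x) ^ 4 = Real.sin x ^ 2 := by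
      rw [show 4 = 2 * 2 by norm_num, pow_mul, Real.sq_sqrt hs.le]
    simp only [Function.comp, mul_pow, h4]
    field_simp
  rw [hsub] at main
  have hsplit : (∫ t in (0 : ℝ)..1, (legendreP l).eval t ^ 4) =
      (∫ t in (0 : ℝ)..(Real.cos a), (legendreP l).eval t ^ 4) +
      ∫ t in (Real.cos a)..1, (legendreP l).eval t ^ 4 :=
    (intervalIntegral.integral_add_adjacent_intervals (cont.intervalIntegrable _ _)
      (cont.intervalIntegrable _ _)).symm
  have hcap0 : 0 ≤ ∫ t in (Real.cos a)..1, (legendreP l).eval t ^ 4 :=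
    intervalIntegral.integral_nonneg hcos1 fun t _ => by positivity
  have hcap1 : ∫ t in (Real.cos a)..1, (legendreP l).eval t ^ 4 ≤ 1 / (l : ℝ) ^ 2 := by
    have h1 : ∫ t in (Real.cos a)..1, (legendreP l).eval t ^ 4 ≤
        ∫ t in (Real.cos a)..1, (1 : ℝ) := by
      refine intervalIntegral.integral_mono_on hcos1 (cont.intervalIntegrable _ _)
        (by simp) fun t ht => ?_
      have := abs_legendreP_eval_le_one l hl (hcos0.trans ht.1) ht.2
      rw [← Even.pow_abs (by decide : Even 4)]
      exact pow_le_one₀ (abs_nonneg _) this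
    have h2 : 1 - Real.cos a ≤ 1 / c ^ 2 := by
      have := Real.sin_sq_add_cos_sq a
      rw [hsa] at this
      have e : (1 / c) ^ 2 = 1 / c ^ 2 := by rw [div_pow, one_pow]
      nlinarith
    have h3 : 1 / c ^ 2 ≤ 1 / (l : ℝ) ^ 2 := by
      apply one_div_le_one_div_of_le (by positivity)
      gcongr; rw [hc]; linarith
    rw [intervalIntegral.integral_const, smul_eq_mul, mul_one] at h1
    linarith
  have hlog2 : Real.log 2 ≤ 1 := by linarith [Real.log_two_lt_d9]
  have hlogc0 : Real.log l ≤ Real.log c := Real.log_le_log (by linarith) (by rw [hc]; linarith)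
  have hlogc1 : Real.log c ≤ Real.log l + 1 := by
    have : Real.log c ≤ Real.log (2 * l) := Real.log_le_log hc0 (by rw [hc]; linarith)
    rw [Real.log_mul two_ne_zero (by linarith)] at this
    linarith
  have hcosl0 : 0 ≤ Real.log (1 + Real.cos a) := Real.log_nonneg (by linarith)
  have hcosl1 : Real.log (1 + Real.cos a) ≤ 1 :=
    (Real.log_le_log (by linarith) (by linarith)).trans hlog2
  have hA : 0 ≤ equatorAmplitude l ^ 2 := by positivity
  rw [hsplit]
  rw [abs_le] at main ⊢
  constructor <;> nlinarith [main.1, main.2]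

theorem integral_legendreP_pow_four_isEquivalent :
    (fun l : ℕ => ∫ t in (0 : ℝ)..1, ((legendreP l).eval t) ^ 4) ~[atTop]
      (fun l : ℕ => 3 / (2 * Real.pi ^ 2) * (Real.log l / (l : ℝ) ^ 2)) := by
  have hlog : Tendsto (fun l : ℕ => Real.log l) atTop atTop :=
    Real.tendsto_log_atTop.comp tendsto_natCast_atTop_atTop
  have hA := tendsto_mul_equatorAmplitude
  set I : ℕ → ℝ := fun l => ∫ t in (0 : ℝ)..1, ((legendreP l).eval t) ^ 4 with hI
  have hev : ∀ᶠ l : ℕ in atTop, 1 ≤ l ∧ 0 < Real.log l :=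
    (eventually_ge_atTop 1).and (hlog.eventually_gt_atTop 0)
  have h1 : Tendsto (fun l : ℕ => I l * l ^ 2 / Real.log l -
      3 / 8 * ((l : ℝ) * equatorAmplitude l) ^ 2) atTop (nhds 0) := by
    have hb : Tendsto (fun l : ℕ => (8 * ((l : ℝ) * equatorAmplitude l) ^ 2 + 1) / Real.log l)
        atTop (nhds 0) :=
      (((hA.pow 2).const_mul 8).add_const 1).div_atTop hlog
    refine squeeze_zero_norm' ?_ hb
    filter_upwards [hev] with l hl
    have hl0 : (0 : ℝ) < l := by exact_mod_cast hl.1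
    have hb := abs_integral_legendreP_pow_four_sub_le l hl.1
    have e : I l * l ^ 2 / Real.log l - 3 / 8 * ((l : ℝ) * equatorAmplitude l) ^ 2 =
        (I l - 3 / 8 * equatorAmplitude l ^ 2 * Real.log l) * ((l : ℝ) ^ 2 / Real.log l) := by
      have := hl.2.ne'
      field_simp
    have hpos : 0 < (l : ℝ) ^ 2 / Real.log l := div_pos (by positivity) hl.2
    rw [Real.norm_eq_abs, e, abs_mul, abs_of_pos hpos]
    refine (mul_le_mul_of_nonneg_right hb hpos.le).trans_eq ?_
    have := hl.2.ne'
    field_simp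
  have h2 : Tendsto (fun l : ℕ => I l * l ^ 2 / Real.log l) atTop
      (nhds (3 / (2 * Real.pi ^ 2))) := by
    have := h1.add ((hA.pow 2).const_mul (3 / 8))
    simp only [sub_add_cancel, zero_add] at this
    convert this using 2
    field_simp
    norm_num
  have hK : 3 / (2 * Real.pi ^ 2) ≠ 0 := by positivity
  refine (isEquivalent_iff_tendsto_one ?_).2 ?_
  · filter_upwards [hev] with l hl
    have hl0 : (0 : ℝ) < l := by exact_mod_cast hl.1
    have := hl.2
    positivity
  · have := h2.div_const (3 / (2 * Real.pi ^ 2))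
    rw [div_self hK] at this
    refine this.congr' ?_
    filter_upwards [hev] with l hl
    have hl0 : (0 : ℝ) < l := by exact_mod_cast hl.1
    have := hl.2.ne'
    simp only [Pi.div_apply, hI]
    field_simp

/-! ### Gaussian moments and integrals of polynomials over the sphere -/

/-- The unnormalized Gaussian moment `∫ x ^ k exp (-x² / 2) dx`. -/
noncomputable def gaussMoment (k : ℕ) : ℝ := ∫ x : ℝ, x ^ k * Real.exp (-(1 / 2) * x ^ 2)

lemma integrable_pow_mul_exp_neg_half_sq (k : ℕ) :
    Integrable fun x : ℝ => x ^ k * Real.exp (-(1 / 2) * x ^ 2) := by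
  have := integrable_rpow_mul_exp_neg_mul_sq (b := 1 / 2) (by norm_num) (s := k)
    (by have : (0 : ℝ) ≤ k := Nat.cast_nonneg k
        linarith)
  simpa only [Real.rpow_natCast] using this

lemma gaussMoment_zero : gaussMoment 0 = √(2 * Real.pi) := by
  have := integral_gaussian (1 / 2)
  simp only [gaussMoment, pow_zero, one_mul]
  rw [this]
  congr 1; ring

lemma gaussMoment_add_two (k : ℕ) : gaussMoment (k + 2) = (k + 1) * gaussMoment k := by
  have h := integral_mul_deriv_eq_deriv_mul_of_integrable
    (u := fun x : ℝ => x ^ (k + 1)) (u' := fun x => ((k : ℝ) + 1) * x ^ k)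
    (v := fun x => Real.exp (-(1 / 2) * x ^ 2))
    (v' := fun x => -(x * Real.exp (-(1 / 2) * x ^ 2)))
    (fun x _ => by simpa using hasDerivAt_pow (k + 1) x)
    (fun x _ => by
      refine (((hasDerivAt_pow 2 x).const_mul (-(1 / 2))).exp).congr_deriv ?_
      simp; ring)
    (by
      convert (integrable_pow_mul_exp_neg_half_sq (k + 2)).neg using 1
      ext x; simp; ring)
    (by
      convert (integrable_pow_mul_exp_neg_half_sq k).const_mul ((k : ℝ) + 1) using 1
      ext x; simp; ring)
    (integrable_pow_mul_exp_neg_half_sq (k + 1))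
  have e1 : ∀ x : ℝ, x ^ (k + 1) * -(x * Real.exp (-(1 / 2) * x ^ 2)) =
    -(x ^ (k + 2) * Real.exp (-(1 / 2) * x ^ 2)) := fun x => by ring
  simp only [e1, integral_neg, mul_assoc, integral_const_mul] at h
  simpa [gaussMoment] using h

lemma gaussMoment_odd {k : ℕ} (hk : Odd k) : gaussMoment k = 0 := by
  have h := integral_neg_eq_self (fun x : ℝ => x ^ k * Real.exp (-(1 / 2) * x ^ 2)) volume
  simp only [hk.neg_pow, even_two.neg_pow, neg_mul, integral_neg] at h
  simp only [gaussMoment, neg_mul]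
  linarith

lemma gaussMoment_even_pos {k : ℕ} (hk : Even k) : 0 < gaussMoment k := by
  obtain ⟨n, rfl⟩ := hk
  induction n with
  | zero => rw [gaussMoment_zero]; positivity
  | succ n ih =>
    rw [show n + 1 + (n + 1) = n + n + 2 by ring, gaussMoment_add_two]
    positivity

lemma integral_Ioi_pow_mul_exp_pos (k : ℕ) :
    0 < ∫ x in Set.Ioi (0 : ℝ), x ^ k * Real.exp (-(1 / 2) * x ^ 2) := by
  have := integral_rpow_mul_exp_neg_mul_rpow (p := 2) (q := k) (b := 1 / 2) (by norm_num)
    (by have : (0 : ℝ) ≤ k := Nat.cast_nonneg k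
        linarith) (by norm_num)
  simp only [Real.rpow_natCast, Real.rpow_two] at this
  rw [this]
  have : 0 < Real.Gamma (((k : ℝ) + 1) / 2) := Real.Gamma_pos_of_pos (by positivity)
  positivity

lemma integral_Ioi_even_pow_mul_exp {k : ℕ} (hk : Even k) :
    ∫ x in Set.Ioi (0 : ℝ), x ^ k * Real.exp (-(1 / 2) * x ^ 2) = gaussMoment k / 2 := by
  have h := integral_comp_abs (f := fun x : ℝ => x ^ k * Real.exp (-(1 / 2) * x ^ 2))
  simp only [hk.pow_abs, sq_abs] at h
  rw [gaussMoment, h]; ring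

instance : IsFiniteMeasure surfaceMeasure := by
  unfold surfaceMeasure; infer_instance

section Sphere
local notation "E3" => EuclideanSpace ℝ (Fin 3)

/-- By rotation invariance, the first coordinate may replace `⟪x, y⟫`; the Gaussian weight then
factorizes. -/
lemma integral_inner_pow_mul_exp (k : ℕ) {y : E3} (hy : ‖y‖ = 1) :
    ∫ x : E3, inner ℝ x y ^ k * Real.exp (-(1 / 2) * ‖x‖ ^ 2) =
      gaussMoment k * gaussMoment 0 ^ 2 := by
  obtain ⟨b, hb⟩ := Orthonormal.exists_orthonormalBasis_extension_of_card_eq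
    (𝕜 := ℝ) (E := E3) (ι := Fin 3) (by simp) (v := fun _ => y) (s := {0})
    (by
      rw [orthonormal_iff_ite]
      rintro ⟨i, hi⟩ ⟨j, hj⟩
      simp only [Set.mem_singleton_iff] at hi hj
      subst hi; subst hj
      simp [hy])
  have hb0 : b 0 = y := hb 0 rfl
  set g : E3 → ℝ := fun z => z 0 ^ k * Real.exp (-(1 / 2) * ‖z‖ ^ 2) with hg
  have h1 : ∀ x : E3, inner ℝ x y ^ k * Real.exp (-(1 / 2) * ‖x‖ ^ 2) = g (b.repr x) := by
    intro x
    simp only [hg, b.repr_apply_apply, hb0, LinearIsometryEquiv.norm_map, real_inner_comm]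
  rw [integral_congr_ae (Eventually.of_forall h1)]
  rw [b.measurePreserving_repr.integral_comp b.repr.toHomeomorph.measurableEmbedding,
    ← (EuclideanSpace.volume_preserving_symm_measurableEquiv_toLp (Fin 3)).symm.integral_comp
      (MeasurableEquiv.measurableEmbedding _)]
  have h2 : ∀ z : Fin 3 → ℝ, g ((MeasurableEquiv.toLp 2 (Fin 3 → ℝ)).symm.symm z) =
      ∏ i : Fin 3, (fun t : ℝ => t ^ (if i = 0 then k else 0) *
        Real.exp (-(1 / 2) * t ^ 2)) (z i) := by
    intro z
    simp [hg, Fin.prod_univ_three, EuclideanSpace.norm_sq_eq, Fin.sum_univ_three, mul_add,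
      Real.exp_add]
    ring
  simp_rw [h2]
  rw [integral_fintype_prod_volume_eq_prod (fun i : Fin 3 => fun t : ℝ =>
    t ^ (if i = 0 then k else 0) * Real.exp (-(1 / 2) * t ^ 2)), Fin.prod_univ_three]
  simp [gaussMoment]
  ring

lemma integral_volumeIoiPow (n : ℕ) (g : ℝ → ℝ) :
    ∫ r : Set.Ioi (0 : ℝ), g r ∂(Measure.volumeIoiPow n) =
      ∫ r in Set.Ioi (0 : ℝ), r ^ n * g r := by
  simp only [Measure.volumeIoiPow, ENNReal.ofReal]
  rw [integral_withDensity_eq_integral_smul,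
    integral_subtype_comap measurableSet_Ioi fun a => Real.toNNReal (a ^ n) • g a,
    setIntegral_congr_fun measurableSet_Ioi fun x hx => ?_]
  · simp only [NNReal.smul_def, Real.coe_toNNReal _ (pow_nonneg (le_of_lt hx) _), smul_eq_mul]
  · exact (measurable_subtype_coe.pow_const _).real_toNNReal

/-- The same integral in polar coordinates. -/
lemma integral_inner_pow_mul_exp_eq_polar (k : ℕ) (y : E3) :
    ∫ x : E3, inner ℝ x y ^ k * Real.exp (-(1 / 2) * ‖x‖ ^ 2) =
      (∫ x : S2, inner ℝ (x : E3) y ^ k ∂surfaceMeasure) *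
        ∫ r in Set.Ioi (0 : ℝ), r ^ (k + 2) * Real.exp (-(1 / 2) * r ^ 2) := by
  set G : E3 → ℝ := fun x => inner ℝ x y ^ k * Real.exp (-(1 / 2) * ‖x‖ ^ 2) with hG
  have h1 : ∫ x, G x = ∫ x : ({(0 : E3)}ᶜ : Set E3), G x ∂(Measure.comap Subtype.val volume) := by
    rw [integral_subtype_comap (measurableSet_singleton _).compl G, restrict_compl_singleton]
  have h2 : ∫ x : ({(0 : E3)}ᶜ : Set E3), G x ∂(Measure.comap Subtype.val volume) =
      ∫ p : S2 × Set.Ioi (0 : ℝ), inner ℝ (p.1 : E3) y ^ k *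
        ((p.2 : ℝ) ^ k * Real.exp (-(1 / 2) * (p.2 : ℝ) ^ 2))
        ∂(surfaceMeasure.prod (Measure.volumeIoiPow 2)) := by
    have := (volume : Measure E3).measurePreserving_homeomorphUnitSphereProd.integral_comp
      (Homeomorph.measurableEmbedding _) (fun p : S2 × Set.Ioi (0 : ℝ) =>
        inner ℝ (p.1 : E3) y ^ k * ((p.2 : ℝ) ^ k * Real.exp (-(1 / 2) * (p.2 : ℝ) ^ 2)))
    simp only [finrank_euclideanSpace, Fintype.card_fin, Nat.add_one_sub_one] at this
    rw [surfaceMeasure]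
    refine Eq.trans ?_ this
    refine integral_congr_ae (Eventually.of_forall fun x => ?_)
    have hx : ‖(x : E3)‖ ≠ 0 := norm_ne_zero_iff.2 x.2
    simp only [hG, homeomorphUnitSphereProd_apply_fst_coe, homeomorphUnitSphereProd_apply_snd_coe,
      inner_smul_left, mul_pow]
    simp
    field_simp
  have h3 := integral_prod_mul (μ := surfaceMeasure) (ν := Measure.volumeIoiPow 2)
    (fun x : S2 => inner ℝ (x : E3) y ^ k)
    (fun r : Set.Ioi (0 : ℝ) => (r : ℝ) ^ k * Real.exp (-(1 / 2) * (r : ℝ) ^ 2))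
  rw [h1, h2, h3, integral_volumeIoiPow 2 (fun r => r ^ k * Real.exp (-(1 / 2) * r ^ 2))]
  congr 1
  refine setIntegral_congr_fun measurableSet_Ioi fun r _ => ?_
  ring

/-- Comparing the two evaluations of the Gaussian integral, with `M_k` the moments: for even `k` the
radial integral is `M_{k+2} / 2 = (k + 1) M_k / 2`, for odd `k` the moment `M_k` vanishes. -/
lemma integral_sphere_inner_pow (k : ℕ) {y : E3} (hy : ‖y‖ = 1) :
    ∫ x : S2, inner ℝ (x : E3) y ^ k ∂surfaceMeasure =
      2 * Real.pi * ∫ t in (-1 : ℝ)..1, t ^ k := by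
  have h := (integral_inner_pow_mul_exp_eq_polar k y).symm.trans (integral_inner_pow_mul_exp k hy)
  rw [integral_pow]
  rcases Nat.even_or_odd k with hk | hk
  · rw [integral_Ioi_even_pow_mul_exp (hk.add even_two), gaussMoment_add_two, gaussMoment_zero,
      Real.sq_sqrt (by positivity)] at h
    have hM := gaussMoment_even_pos hk
    rw [(hk.add_one).neg_one_pow]
    have : gaussMoment k * ((∫ x : S2, inner ℝ (x : E3) y ^ k ∂surfaceMeasure) * (k + 1)) =
        gaussMoment k * (4 * Real.pi) := by linear_combination 2 * h
    have := mul_left_cancel₀ hM.ne' this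
    field_simp
    simp
    linarith
  · rw [gaussMoment_odd hk, zero_mul] at h
    have := (mul_eq_zero.1 h).resolve_right (integral_Ioi_pow_mul_exp_pos (k + 2)).ne'
    rw [this, (hk.add_one).neg_one_pow]
    simp

/-- Archimedes' hat-box theorem for polynomials. -/
theorem integral_sphere_eval_inner (p : Polynomial ℝ) {y : E3} (hy : ‖y‖ = 1) :
    ∫ x : S2, p.eval (inner ℝ (x : E3) y) ∂surfaceMeasure =
      2 * Real.pi * ∫ t in (-1 : ℝ)..1, p.eval t := by
  simp_rw [Polynomial.eval_eq_sum_range]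
  rw [integral_finsetSum, intervalIntegral.integral_finsetSum, Finset.mul_sum]
  · refine Finset.sum_congr rfl fun i _ => ?_
    rw [integral_const_mul, intervalIntegral.integral_const_mul, integral_sphere_inner_pow i hy]
    ring
  · intro i _
    apply Continuous.intervalIntegrable
    fun_prop
  · intro i _
    apply Continuous.integrable_of_hasCompactSupport
    · fun_prop
    · exact HasCompactSupport.of_compactSpace _

lemma surfaceMeasure_real_univ : surfaceMeasure.real Set.univ = 4 * Real.pi := by
  have h := integral_sphere_eval_inner 1 (y := EuclideanSpace.single 0 1) (by simp)
  simp at h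
  rw [h]; ring

lemma integral_neg_one_one_legendreP_pow_four (l : ℕ) :
    ∫ t in (-1 : ℝ)..1, (legendreP l).eval t ^ 4 =
      2 * ∫ t in (0 : ℝ)..1, (legendreP l).eval t ^ 4 := by
  have cont : Continuous fun t : ℝ => (legendreP l).eval t ^ 4 := (legendreP l).continuous.pow 4
  rw [← intervalIntegral.integral_add_adjacent_intervals (b := 0) (cont.intervalIntegrable _ _)
    (cont.intervalIntegrable _ _)]
  have h := intervalIntegral.integral_comp_neg (a := 0) (b := 1)
    (fun t : ℝ => (legendreP l).eval t ^ 4)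
  have e : ∀ t : ℝ, (legendreP l).eval (-t) ^ 4 = (legendreP l).eval t ^ 4 := by
    intro t
    rw [legendreP_eval_neg, mul_pow, ← pow_mul, mul_comm l 4, pow_mul]
    norm_num
  simp only [e, neg_zero] at h
  rw [← h]; ring

/-- The double integral of the fourth power of the covariance. -/
lemma integral_prod_legendreP_pow_four (l : ℕ) :
    ∫ p : S2 × S2, (legendreP l).eval (inner ℝ (p.1 : E3) (p.2 : E3)) ^ 4
        ∂(surfaceMeasure.prod surfaceMeasure) =
      (4 * Real.pi) ^ 2 * ∫ t in (0 : ℝ)..1, (legendreP l).eval t ^ 4 := by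
  rw [integral_prod_symm]
  · have h : ∀ y : S2, ∫ x : S2, (legendreP l).eval (inner ℝ (x : E3) (y : E3)) ^ 4
        ∂surfaceMeasure = 4 * Real.pi * ∫ t in (0 : ℝ)..1, (legendreP l).eval t ^ 4 := by
      intro y
      have := integral_sphere_eval_inner (legendreP l ^ 4) (y := (y : E3)) (by simp)
      simp only [Polynomial.eval_pow] at this
      rw [this, integral_neg_one_one_legendreP_pow_four]
      ring
    simp only [h, integral_const, surfaceMeasure_real_univ, smul_eq_mul]
    ring
  · apply Continuous.integrable_of_hasCompactSupport
    · have := (legendreP l).continuous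
      fun_prop
    · exact HasCompactSupport.of_compactSpace _

end Sphere

/-! ### Hermite polynomials of Gaussian variables and fields -/

lemma integrable_pow_gaussianReal (m : ℝ) (v : NNReal) (k : ℕ) :
    Integrable (fun x : ℝ => x ^ k) (gaussianReal m v) := by
  rcases eq_or_ne k 0 with rfl | hk
  · simp
  · have := (memLp_id_gaussianReal (μ := m) (v := v) k).integrable_norm_pow hk
    rw [← integrable_norm_iff (by fun_prop)]
    simpa using this

lemma integral_pow_gaussianReal_zero_one (k : ℕ) :
    ∫ x, x ^ k ∂(gaussianReal 0 1) = gaussMoment k / √(2 * Real.pi) := by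
  rw [integral_gaussianReal_eq_integral_smul one_ne_zero, gaussMoment, div_eq_inv_mul,
    ← integral_const_mul]
  refine integral_congr_ae (Eventually.of_forall fun x => ?_)
  simp only [gaussianPDFReal, smul_eq_mul, NNReal.coe_one, mul_one, sub_zero]
  rw [show -x ^ 2 / 2 = -(1 / 2) * x ^ 2 by ring]
  ring

lemma integral_pow_gaussianReal (v : NNReal) (k : ℕ) :
    ∫ x, x ^ k ∂(gaussianReal 0 v) = √(v : ℝ) ^ k * (gaussMoment k / √(2 * Real.pi)) := by
  have h := gaussianReal_map_const_mul (μ := 0) (v := 1) (√(v : ℝ))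
  have e : gaussianReal 0 v = (gaussianReal 0 1).map (√(v : ℝ) * ·) := by
    rw [h, mul_zero]
    congr 1
    ext
    simp [Real.sq_sqrt]
  rw [e, integral_map (by fun_prop) (by fun_prop)]
  simp only [mul_pow]
  rw [integral_const_mul, integral_pow_gaussianReal_zero_one]

lemma integral_even_pow_gaussianReal (v : NNReal) (k : ℕ) :
    ∫ x, x ^ (2 * k) ∂(gaussianReal 0 v) =
      (v : ℝ) ^ k * ∏ i ∈ Finset.range k, (2 * (i : ℝ) + 1) := by
  rw [integral_pow_gaussianReal, pow_mul, Real.sq_sqrt (NNReal.coe_nonneg v)]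
  congr 1
  induction k with
  | zero => rw [mul_zero, gaussMoment_zero, div_self (by positivity)]; simp
  | succ k ih =>
    rw [Finset.prod_range_succ, ← ih, mul_add, mul_one, gaussMoment_add_two]
    push_cast; ring

lemma integral_odd_pow_gaussianReal (v : NNReal) {k : ℕ} (hk : Odd k) :
    ∫ x, x ^ k ∂(gaussianReal 0 v) = 0 := by
  rw [integral_pow_gaussianReal, gaussMoment_odd hk]; simp

lemma aeval_hermite_four (x : ℝ) :
    Polynomial.aeval x (Polynomial.hermite 4) = x ^ 4 - 6 * x ^ 2 + 3 := by
  simp [Polynomial.hermite_succ]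
  ring

/-- For `v = 1 - r²` and `a = r x` the right-hand side is `r ^ 4 (x ^ 4 - 6 x ^ 2 + 3)`: averaging
the Hermite polynomial over independent noise rescales it. -/
lemma integral_hermite_four_add (v : NNReal) (a : ℝ) :
    ∫ w, ((a + w) ^ 4 - 6 * (a + w) ^ 2 + 3) ∂(gaussianReal 0 v) =
      a ^ 4 + 6 * (v - 1) * a ^ 2 + 3 * (v - 1) ^ 2 := by
  have hI := integrable_pow_gaussianReal 0 v
  have e : ∀ w : ℝ, (a + w) ^ 4 - 6 * (a + w) ^ 2 + 3 =
      ∑ k : Fin 5, (![a ^ 4 - 6 * a ^ 2 + 3, 4 * a ^ 3 - 12 * a, 6 * a ^ 2 - 6, 4 * a, 1] k) *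
        w ^ (k : ℕ) := by
    intro w
    simp [Fin.sum_univ_five]
    ring
  have m3 := integral_odd_pow_gaussianReal v (k := 3) (by decide)
  have m2 := integral_even_pow_gaussianReal v 1
  have m4 := integral_even_pow_gaussianReal v 2
  simp_rw [e]
  rw [integral_finsetSum _ fun k _ => (hI _).const_mul _]
  simp only [integral_const_mul, Fin.sum_univ_five]
  simp [Finset.prod_range_succ] at m2 m3 m4 ⊢
  rw [m2, m3, m4]
  ring

lemma integral_hermite_four_sq :
    ∫ x, (x ^ 4 - 6 * x ^ 2 + 3) ^ 2 ∂(gaussianReal 0 1) = 24 := by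
  have hI := integrable_pow_gaussianReal 0 1
  have e : ∀ x : ℝ, (x ^ 4 - 6 * x ^ 2 + 3) ^ 2 =
      ∑ k : Fin 5, (![9, -36, 42, -12, 1] k) * x ^ (2 * (k : ℕ)) := by
    intro w
    simp [Fin.sum_univ_five]
    ring
  simp_rw [e]
  rw [integral_finsetSum _ fun k _ => (hI _).const_mul _]
  simp only [integral_const_mul, integral_even_pow_gaussianReal]
  simp [Fin.sum_univ_five, Finset.prod_range_succ]
  norm_num

lemma memLp_hermite_four_gaussianReal (m : ℝ) (v : NNReal) :
    MemLp (fun x : ℝ => x ^ 4 - 6 * x ^ 2 + 3) 2 (gaussianReal m v) := by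
  have hI := integrable_pow_gaussianReal m v
  rw [memLp_two_iff_integrable_sq (by fun_prop)]
  have e : (fun x : ℝ => (x ^ 4 - 6 * x ^ 2 + 3) ^ 2) =
      fun x => x ^ 8 - 12 * x ^ 6 + 42 * x ^ 4 - 36 * x ^ 2 + 9 * x ^ 0 := by
    ext x; ring
  rw [e]
  exact ((((hI 8).sub ((hI 6).const_mul 12)).add ((hI 4).const_mul 42)).sub
    ((hI 2).const_mul 36)).add ((hI 0).const_mul 9)

section
variable {Ω : Type*} [MeasurableSpace Ω] {P : Measure Ω} {X Y : Ω → ℝ}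

lemma map_eq_gaussianReal_of_moments [IsProbabilityMeasure P] (hX : HasGaussianLaw X P)
    (h0 : ∫ ω, X ω ∂P = 0) {s : NNReal} (h1 : ∫ ω, X ω ^ 2 ∂P = s) :
    P.map X = gaussianReal 0 s := by
  rw [hX.map_eq_gaussianReal, h0, variance_of_integral_eq_zero hX.aemeasurable h0, h1]
  simp

lemma memLp_hermite_four_comp (hX : HasGaussianLaw X P) :
    MemLp (fun ω => X ω ^ 4 - 6 * X ω ^ 2 + 3) 2 P := by
  have h := memLp_hermite_four_gaussianReal (∫ ω, X ω ∂P) (variance X P).toNNReal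
  rw [← hX.map_eq_gaussianReal] at h
  exact (memLp_map_measure_iff (by fun_prop) hX.aemeasurable).1 h

lemma integral_hermite_four_comp [IsProbabilityMeasure P] (hX : HasGaussianLaw X P)
    (h0 : ∫ ω, X ω ∂P = 0) (h1 : ∫ ω, X ω ^ 2 ∂P = 1) :
    ∫ ω, (X ω ^ 4 - 6 * X ω ^ 2 + 3) ∂P = 0 := by
  have hm := map_eq_gaussianReal_of_moments hX h0 (s := 1) (by simpa using h1)
  have := integral_hermite_four_add 1 0
  rw [← hm, integral_map hX.aemeasurable (by fun_prop)] at this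
  simpa using this

/-- `𝔼[H_4 X * H_4 Y] = 4! 𝔼[X * Y] ^ 4` for jointly Gaussian standard variables: `Y - r X` is
independent of `X`, also in the degenerate case `r = ± 1`. -/
theorem integral_hermite_four_mul_hermite_four [IsProbabilityMeasure P]
    (hXY : HasGaussianLaw (fun ω => (X ω, Y ω)) P)
    (hX0 : ∫ ω, X ω ∂P = 0) (hY0 : ∫ ω, Y ω ∂P = 0)
    (hX1 : ∫ ω, X ω ^ 2 ∂P = 1) (hY1 : ∫ ω, Y ω ^ 2 ∂P = 1) {r : ℝ}
    (hr : ∫ ω, X ω * Y ω ∂P = r) :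
    ∫ ω, (X ω ^ 4 - 6 * X ω ^ 2 + 3) * (Y ω ^ 4 - 6 * Y ω ^ 2 + 3) ∂P = 24 * r ^ 4 := by
  have hX := hXY.fst
  have hY := hXY.snd
  have X2 := hX.memLp_two
  have Y2 := hY.memLp_two
  have iXY : Integrable (fun ω => X ω * Y ω) P := X2.integrable_mul Y2
  have iX := hX.integrable
  have iY := hY.integrable
  have iXX := X2.integrable_sq
  have iYY := Y2.integrable_sq
  set W : Ω → ℝ := fun ω => Y ω - r * X ω with hW
  have hXW : HasGaussianLaw (fun ω => (X ω, W ω)) P :=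
    hXY.map_fun ((ContinuousLinearMap.fst ℝ ℝ ℝ).prod
      (ContinuousLinearMap.snd ℝ ℝ ℝ - r • ContinuousLinearMap.fst ℝ ℝ ℝ))
  have hWg := hXW.snd
  have hW0 : ∫ ω, W ω ∂P = 0 := by
    rw [hW, integral_sub iY (iX.const_mul r), integral_const_mul, hX0, hY0]; simp
  have hW1 : ∫ ω, W ω ^ 2 ∂P = 1 - r ^ 2 := by
    have e : ∀ ω, W ω ^ 2 = (Y ω ^ 2 - 2 * r * (X ω * Y ω)) + r ^ 2 * X ω ^ 2 := fun ω => by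
      simp only [hW]; ring
    simp_rw [e]
    have i1 : Integrable (fun ω => Y ω ^ 2 - 2 * r * (X ω * Y ω)) P := iYY.sub (iXY.const_mul _)
    rw [integral_add i1 (iXX.const_mul _),
      integral_sub iYY (iXY.const_mul _), integral_const_mul, integral_const_mul, hX1, hY1, hr]
    ring
  have hrs : 0 ≤ 1 - r ^ 2 := by rw [← hW1]; exact integral_nonneg fun ω => sq_nonneg _
  set s : NNReal := ⟨1 - r ^ 2, hrs⟩ with hs
  have hcov : cov[X, W; P] = 0 := by
    rw [covariance_eq_sub X2 hWg.memLp_two, hX0, zero_mul, sub_zero]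
    have e : ∀ ω, (X * W) ω = X ω * Y ω - r * X ω ^ 2 := fun ω => by
      simp only [hW, Pi.mul_apply]; ring
    simp_rw [e]
    rw [integral_sub iXY (iXX.const_mul _), integral_const_mul, hX1, hr]
    ring
  have hind := hXW.indepFun_of_covariance_eq_zero hcov
  have mX := map_eq_gaussianReal_of_moments hX hX0 (s := 1) (by simpa using hX1)
  have mW := map_eq_gaussianReal_of_moments hWg hW0 (s := s) (by rw [hW1]; rfl)
  have hmap : P.map (fun ω => (X ω, W ω)) = (gaussianReal 0 1).prod (gaussianReal 0 s) := by
    rw [(indepFun_iff_map_prod_eq_prod_map_map hX.aemeasurable hWg.aemeasurable).1 hind, mX, mW]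
  set G : ℝ × ℝ → ℝ := fun p => (p.1 ^ 4 - 6 * p.1 ^ 2 + 3) *
    ((r * p.1 + p.2) ^ 4 - 6 * (r * p.1 + p.2) ^ 2 + 3) with hG
  have hGc : Continuous G := by fun_prop
  have hYW : ∀ ω, (X ω ^ 4 - 6 * X ω ^ 2 + 3) * (Y ω ^ 4 - 6 * Y ω ^ 2 + 3) = G (X ω, W ω) :=
    fun ω => by simp [hG, hW]
  have hint : Integrable (fun ω => G (X ω, W ω)) P := by
    simp_rw [← hYW]
    exact (memLp_hermite_four_comp hX).integrable_mul (memLp_hermite_four_comp hY)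
  simp_rw [hYW]
  rw [← integral_map (f := G) hXW.aemeasurable hGc.aestronglyMeasurable]
  have hGi : Integrable G (P.map fun ω => (X ω, W ω)) :=
    (integrable_map_measure hGc.aestronglyMeasurable hXW.aemeasurable).2 hint
  rw [hmap] at hGi ⊢
  rw [integral_prod _ hGi]
  have inner_int : ∀ x : ℝ, ∫ w, G (x, w) ∂(gaussianReal 0 s) =
      r ^ 4 * (x ^ 4 - 6 * x ^ 2 + 3) ^ 2 := by
    intro x
    simp only [hG]
    rw [integral_const_mul, integral_hermite_four_add]
    have : (s : ℝ) = 1 - r ^ 2 := rfl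
    rw [this]
    ring
  simp_rw [inner_int]
  rw [integral_const_mul, integral_hermite_four_sq]
  ring

end

/-- A field with almost surely continuous paths is jointly measurable up to a null set, as the limit
of the fields evaluated at simple approximations of the point. -/
lemma aemeasurable_uncurry_of_continuous {T Ω : Type*} [MetricSpace T] [SecondCountableTopology T]
    [Nonempty T] [MeasurableSpace T] [BorelSpace T] [MeasurableSpace Ω] {P : Measure Ω} [SFinite P]
    {μ : Measure T} [SFinite μ] {f : T → Ω → ℝ} (hf : ∀ x, AEMeasurable (f x) P)
    (hc : ∀ᵐ ω ∂P, Continuous fun x => f x ω) :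
    AEMeasurable (Function.uncurry f) (μ.prod P) := by
  let t₀ : T := Classical.arbitrary T
  let φ : ℕ → SimpleFunc T T :=
    SimpleFunc.approxOn id measurable_id Set.univ t₀ (Set.mem_univ _)
  have hφ : ∀ x, Tendsto (fun n => φ n x) atTop (nhds x) := fun x =>
    SimpleFunc.tendsto_approxOn measurable_id (Set.mem_univ _) (by simp)
  -- On each of the finitely many level sets of `φ n` the field depends on `ω` only.
  refine aemeasurable_of_tendsto_metrizable_ae (u := atTop)
    (f := fun n p => f (φ n p.1) p.2) (fun n => ?_) ?_
  · have e : (fun p : T × Ω => f (φ n p.1) p.2) = fun p =>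
        ∑ y ∈ (φ n).range, (Set.indicator (φ n ⁻¹' {y}) (fun _ => (1 : ℝ)) p.1) * f y p.2 := by
      ext p
      rw [Finset.sum_eq_single (φ n p.1)]
      · simp
      · intro y _ hy
        rw [Set.indicator_of_notMem, zero_mul]
        simpa using hy.symm
      · intro h
        exact absurd (SimpleFunc.mem_range_self _ _) h
    rw [e]
    refine Finset.aemeasurable_fun_sum _ fun y _ => ?_
    refine AEMeasurable.mul ?_ ((hf y).comp_quasiMeasurePreserving
      Measure.quasiMeasurePreserving_snd)
    exact ((measurable_const.indicator ((φ n).measurableSet_preimage _)).comp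
      measurable_fst).aemeasurable
  · filter_upwards [Measure.quasiMeasurePreserving_snd.ae hc] with p hp
    exact (hp.tendsto p.1).comp (hφ p.1)

/-- The integral of a centred random field of constant second moment is square integrable, and its
variance is the double integral of the covariance. -/
lemma memLp_integral_and_variance {T Ω : Type*} [MeasurableSpace T] [MeasurableSpace Ω]
    {P : Measure Ω} [IsProbabilityMeasure P] {μ : Measure T} [IsFiniteMeasure μ]
    {g : T → Ω → ℝ} (hg : AEStronglyMeasurable (Function.uncurry g) (μ.prod P))
    (h2 : ∀ x, MemLp (g x) 2 P) {C : ℝ} (hC : ∀ x, ∫ ω, g x ω ^ 2 ∂P = C)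
    (h0 : ∀ x, ∫ ω, g x ω ∂P = 0) :
    MemLp (fun ω => ∫ x, g x ω ∂μ) 2 P ∧
      variance (fun ω => ∫ x, g x ω ∂μ) P =
        ∫ p : T × T, (∫ ω, g p.1 ω * g p.2 ω ∂P) ∂(μ.prod μ) := by
  have hpair : ∀ x y, ∫ ω, ‖g x ω * g y ω‖ ∂P ≤ C := by
    intro x y
    have i := (((h2 x).integrable_sq.add (h2 y).integrable_sq).div_const 2)
    have := integral_mono ((h2 x).integrable_mul (h2 y)).norm i fun ω => by
      simp only [Pi.mul_apply, Pi.add_apply, Real.norm_eq_abs, abs_mul]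
      nlinarith [sq_nonneg (|g x ω| - |g y ω|), sq_abs (g x ω), sq_abs (g y ω)]
    refine this.trans_eq ?_
    simp only [Pi.add_apply]
    rw [integral_div, integral_add (h2 x).integrable_sq (h2 y).integrable_sq, hC, hC]
    ring
  -- Fubini is applied to the product field on `(T × T) × Ω`.
  have q1 : Measure.QuasiMeasurePreserving (fun p : (T × T) × Ω => (p.1.1, p.2))
      ((μ.prod μ).prod P) (μ.prod P) :=
    MeasureTheory.QuasiMeasurePreserving.prodMap Measure.quasiMeasurePreserving_fst
      (Measure.QuasiMeasurePreserving.id P)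
  have q2 : Measure.QuasiMeasurePreserving (fun p : (T × T) × Ω => (p.1.2, p.2))
      ((μ.prod μ).prod P) (μ.prod P) :=
    MeasureTheory.QuasiMeasurePreserving.prodMap Measure.quasiMeasurePreserving_snd
      (Measure.QuasiMeasurePreserving.id P)
  have hFm : AEStronglyMeasurable (fun p : (T × T) × Ω => g p.1.1 p.2 * g p.1.2 p.2)
      ((μ.prod μ).prod P) :=
    (hg.comp_quasiMeasurePreserving q1).mul (hg.comp_quasiMeasurePreserving q2)
  have hFi : Integrable (fun p : (T × T) × Ω => g p.1.1 p.2 * g p.1.2 p.2)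
      ((μ.prod μ).prod P) := by
    rw [integrable_prod_iff hFm]
    refine ⟨Eventually.of_forall fun p => (h2 p.1).integrable_mul (h2 p.2), ?_⟩
    refine Integrable.mono' (integrable_const C) hFm.norm.integral_prod_right'
      (Eventually.of_forall fun p => ?_)
    rw [Real.norm_eq_abs, abs_of_nonneg (integral_nonneg fun _ => norm_nonneg _)]
    exact hpair p.1 p.2
  have hgi : Integrable (Function.uncurry g) (μ.prod P) := by
    rw [integrable_prod_iff hg]
    refine ⟨Eventually.of_forall fun x => (h2 x).integrable one_le_two, ?_⟩
    refine Integrable.mono' (integrable_const (C + 1)) hg.norm.integral_prod_right'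
      (Eventually.of_forall fun x => ?_)
    rw [Real.norm_eq_abs, abs_of_nonneg (integral_nonneg fun _ => norm_nonneg _)]
    have := integral_mono ((h2 x).integrable one_le_two).norm
      ((h2 x).integrable_sq.add (integrable_const 1)) fun ω => by
        simp only [Pi.add_apply, Real.norm_eq_abs]
        nlinarith [sq_nonneg (|g x ω| - 1), sq_abs (g x ω)]
    simp only [Pi.add_apply] at this
    rw [integral_add (h2 x).integrable_sq (integrable_const 1), hC] at this
    simpa using this
  have hsq : ∀ ω, ∫ p : T × T, g p.1 ω * g p.2 ω ∂(μ.prod μ) = (∫ x, g x ω ∂μ) ^ 2 := fun ω => by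
    rw [integral_prod_mul (fun x => g x ω) (fun x => g x ω), sq]
  have hm : AEStronglyMeasurable (fun ω => ∫ x, g x ω ∂μ) P :=
    hgi.integral_prod_right.aestronglyMeasurable
  have hmean : ∫ ω, (∫ x, g x ω ∂μ) ∂P = 0 := by
    rw [← integral_integral_swap hgi]
    simp [h0]
  have hL2 : MemLp (fun ω => ∫ x, g x ω ∂μ) 2 P := by
    rw [memLp_two_iff_integrable_sq hm]
    simpa only [hsq] using hFi.integral_prod_right
  refine ⟨hL2, ?_⟩
  rw [variance_of_integral_eq_zero hm.aemeasurable hmean]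
  simp_rw [← hsq]
  exact (integral_integral_swap (f := fun (p : T × T) ω => g p.1 ω * g p.2 ω) hFi).symm

/-- The exact variance of `∫ H_4 (f x) dx`, for a single degree `l`. -/
theorem memLp_hermiteStat_four_and_variance {Ω : Type*} [MeasurableSpace Ω] {P : Measure Ω}
    [IsProbabilityMeasure P] {l : ℕ} {f : S2 → Ω → ℝ} (hf : IsGaussianEigenfunction l f P) :
    MemLp (hermiteStat 4 f) 2 P ∧
      variance (hermiteStat 4 f) P = (Nat.factorial 4 : ℝ) * (4 * Real.pi) ^ 2 *
        ∫ t in (0 : ℝ)..1, ((legendreP l).eval t) ^ 4 := by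
  have hone : ∀ x : S2, ∫ ω, f x ω ^ 2 ∂P = 1 := by
    intro x
    have h := hf.covariance x x
    rw [real_inner_self_eq_norm_sq] at h
    simp only [norm_eq_of_mem_sphere, one_pow, legendreP_eval_one] at h
    simpa only [sq] using h
  have hpair : ∀ x y : S2, ∫ ω, (f x ω ^ 4 - 6 * f x ω ^ 2 + 3) *
      (f y ω ^ 4 - 6 * f y ω ^ 2 + 3) ∂P = 24 * (legendreP l).eval
        (inner ℝ (x : EuclideanSpace ℝ (Fin 3)) (y : EuclideanSpace ℝ (Fin 3))) ^ 4 := fun x y =>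
    integral_hermite_four_mul_hermite_four hf.gaussian.hasGaussianLaw_prodMk
      (hf.centred x) (hf.centred y) (hone x) (hone y) (hf.covariance x y)
  have hne : Nonempty S2 := ⟨⟨EuclideanSpace.single 0 1, by simp⟩⟩
  have hmeas : AEMeasurable (Function.uncurry f) (surfaceMeasure.prod P) :=
    aemeasurable_uncurry_of_continuous hf.gaussian.aemeasurable hf.continuous_paths
  have hmeas' : AEStronglyMeasurable
      (Function.uncurry fun x ω => f x ω ^ 4 - 6 * f x ω ^ 2 + 3) (surfaceMeasure.prod P) :=
    (((hmeas.pow_const 4).sub ((hmeas.pow_const 2).const_mul 6)).add_const 3).aestronglyMeasurable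
  obtain ⟨h1, h2⟩ := memLp_integral_and_variance hmeas'
    (fun x => memLp_hermite_four_comp (hf.gaussian.hasGaussianLaw_eval x)) (C := 24)
    (fun x => by
      have := hpair x x
      rw [real_inner_self_eq_norm_sq] at this
      simp only [norm_eq_of_mem_sphere, one_pow, legendreP_eval_one, mul_one] at this
      simpa only [sq (_ + (3 : ℝ))] using this)
    (fun x => integral_hermite_four_comp (hf.gaussian.hasGaussianLaw_eval x) (hf.centred x)
      (hone x))
  have hstat : hermiteStat 4 f =
      fun ω => ∫ x, (f x ω ^ 4 - 6 * f x ω ^ 2 + 3) ∂surfaceMeasure := by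
    ext ω
    simp only [hermiteStat, aeval_hermite_four]
  rw [hstat]
  refine ⟨h1, ?_⟩
  rw [h2]
  simp_rw [hpair]
  rw [integral_const_mul, integral_prod_legendreP_pow_four]
  simp [Nat.factorial]
  ring

theorem lemma3p2 {Ω : ℕ → Type*} [∀ l, MeasurableSpace (Ω l)]
    (P : ∀ l, Measure (Ω l)) [∀ l, IsProbabilityMeasure (P l)]
    (f : ∀ l, S2 → Ω l → ℝ)
    (hf : ∀ l, 1 ≤ l → IsGaussianEigenfunction l (f l) (P l)) :
    (∀ l, 1 ≤ l →
      MemLp (hermiteStat 4 (f l)) 2 (P l) ∧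
      variance (hermiteStat 4 (f l)) (P l) =
        (Nat.factorial 4 : ℝ) * (4 * Real.pi) ^ 2 *
          ∫ t in (0 : ℝ)..1, ((legendreP l).eval t) ^ 4) ∧
    (fun l : ℕ => ∫ t in (0 : ℝ)..1, ((legendreP l).eval t) ^ 4) ~[atTop]
      (fun l : ℕ => 3 / (2 * Real.pi ^ 2) * (Real.log l / (l : ℝ) ^ 2)) ∧
    (fun l : ℕ => variance (hermiteStat 4 (f l)) (P l)) ~[atTop]
      (fun l : ℕ => 24 ^ 2 * (Real.log l / (l : ℝ) ^ 2)) := by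
  have hvar := fun l hl => memLp_hermiteStat_four_and_variance (hf l hl)
  refine ⟨hvar, integral_legendreP_pow_four_isEquivalent, ?_⟩
  have h := (IsEquivalent.refl (u := fun _ : ℕ => (Nat.factorial 4 : ℝ) * (4 * Real.pi) ^ 2)
    (l := atTop)).mul integral_legendreP_pow_four_isEquivalent
  refine (h.congr_left ?_).congr_right ?_
  · filter_upwards [eventually_ge_atTop 1] with l hl
    exact (hvar l hl).2.symm
  · refine Eventually.of_forall fun l => ?_
    simp [Nat.factorial]
    field_simp
    norm_num
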